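/- **Language.** Formulas of the unary modal language are built from $\top$ and propositional letters with $\neg,\vee,\Diamond,\Box$ (other connectives are abbreviations, $\bot=\neg\top$); $|\varphi|$ is the number of symbols of $\varphi$ and $md(\varphi)$ its modal depth. They are interpreted on Kripke structures; for $\mathbf L=\mathbf K,\mathbf T,\mathbf{K4},\mathbf{S4}$ the frames are all frames, the reflexive, the transitive, and the reflexive and transitive ones. A formula of $\mathbf L^{Horn,\Box}$ is a conjunction $\varphi=\varphi_1\wedge\dots\wedge\varphi_l$ of clauses $\Box^s(\lambda_1\wedge\dots\wedge\lambda_n\to\lambda)$ with $s,n\ge 0$, where $\lambda_1,\dots,\lambda_n$ are positive literals ($\lambda::=\top\mid p\mid\Box\lambda$) and $\lambda$ is a positive literal or $\bot$. $Cl(\varphi)$ is the set of subformulas of $\varphi$. **Procedure.** HornBoxSat$(\mathbf L,\varphi)$ works on a structure $(W,H,L)$ with worlds $W=\{w_0,w_1,\dots\}$ in which each world $w$ carries sets $H(w),L(w)$ of formulas. It starts with $W=\{w_0\}$, $H(w_0)=\{\varphi_1,\dots,\varphi_l\}$, $L(w_0)=\{\top\}$. Let $N=md(\varphi)$ if $\mathbf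 L\in\{\mathbf K,\mathbf T\}$ and $N=|\varphi|$ if $\mathbf L\in\{\mathbf{K4},\mathbf{S4}\}$. For $d=0,\dots,N$ it calls Saturate; on True it adds a world $w_{d+1}$ with $H(w_{d+1})=\emptyset$, $L(w_{d+1})=\{\top\}$; on False it returns the answer of Shorten$(d)$. When the loop ends it returns True. *Shorten$(d)$*: for $k=d,d-1,\dots,1$, delete $w_k$, add all $\Box\lambda\in Cl(\varphi)$ with $\lambda$ a positive literal to $H(w_{k-1})$, and call Saturate; if it returns True, return True. After the loop return False. *Saturate*: as long as some choice of $w_k\in W$ and $\psi\in H(w_k)\cup L(w_k)$ has an effect (it returns False, or changes $H(w)\cup L(w)$ or $L(w)$ for some $w$), take any such choice and do the following; then return True. 1. If $\mathbf L\in\{\mathbf{K4},\mathbf{S4}\}$, $k=N$ and $\Box\psi\in Cl(\varphi)$, add $\Box\psi$ to $H(w_k)$. 2. If $k\ge1$ and $\Box\psi\in Cl(\varphi)$, and, for $\mathbf L\in\{\mathbf{K4},\mathbf{S4}\}$, also $\Box\psi\in H(w_k)\cup L(w_k)$, and, for $\mathbf L\in\{\mathbf T,\mathbf{S4}\}$,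 also $\psi\in H(w_{k-1})\cup L(w_{k-1})$, add $\Box\psi$ to $H(w_{k-1})$. 3. If $\psi=p$ is a letter, move it from $H(w_k)$ to $L(w_k)$. If $\psi=\Box\xi$: for $\mathbf L\in\{\mathbf T,\mathbf{S4}\}$ add $\xi$ to $H(w_k)$; and if $w_{k+1}\in W$, move $\psi$ from $H(w_k)$ to $L(w_k)$ and add $\xi$ (for $\mathbf L\in\{\mathbf{K4},\mathbf{S4}\}$: $\xi$ and $\Box\xi$) to $H(w_{k+1})$. If $\psi=\lambda_1\wedge\dots\wedge\lambda_n\to\lambda$ and $\{\lambda_1,\dots,\lambda_n\}\subseteq H(w_k)\cup L(w_k)$: if $\lambda=\bot$ return False, otherwise add $\lambda$ to $H(w_k)$ and move $\psi$ from $H(w_k)$ to $L(w_k)$. **Theorem.** Let $\mathbf L\in\{\mathbf K,\mathbf T,\mathbf{K4},\mathbf{S4}\}$ and let $\varphi$ be an $\mathbf L^{Horn,\Box}$-formula. Whatever choices are made in Saturate, HornBoxSat$(\mathbf L,\varphi)$ terminates; it returns True if $\varphi$ is satisfiable in $\mathbf L$ and False otherwise. The number of steps (loop iterations, calls and returns)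 is $O(|\varphi|^3)$, with a constant that depends neither on $\mathbf L$, nor on $\varphi$, nor on the choices. The running time is polynomial in $|\varphi|$ (uniformly in $\mathbf L$ and the choices) when labels are stored as marked lists of the formulas in $Cl(\varphi)\cup\{\top\}$, formulas are compared symbol by symbol, and the condition of the while loop is evaluated by trying all $w_k$ and $\psi$. -/

import Mathlib

universe u

namespace HornBox

/-! ### The modal language and its Kripke semantics -/

/-- Formulas of the unary modal language; the other connectives are abbreviations. -/
inductive Modal : Type
  | top : Modal
  | letter (p : ℕ) : Modal
  | neg (a : Modal) : Modal
  | or (a b : Modal) : Modal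
  | dia (a : Modal) : Modal
  | box (a : Modal) : Modal

namespace Modal

def bot : Modal := neg top

def and (a b : Modal) : Modal := neg (or (neg a) (neg b))

def imp (a b : Modal) : Modal := or (neg a) b

/-- The conjunction of a list of formulas; the empty conjunction is `⊤`. -/
def bigAnd : List Modal → Modal
  | [] => top
  | [a] => a
  | a :: b :: l => and a (bigAnd (b :: l))

/-- The number of symbols of a formula. -/
def length : Modal → ℕ
  | top => 1
  | letter _ => 1
  | neg a => a.length + 1
  | or a b => a.length + b.length + 1
  | dia a => a.length + 1
  | box a => a.length + 1

/-- The modal depth: the maximum number of nested boxes and diamonds. -/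
def depth : Modal → ℕ
  | top => 0
  | letter _ => 0
  | neg a => a.depth
  | or a b => max a.depth b.depth
  | dia a => a.depth + 1
  | box a => a.depth + 1

end Modal

/-- A Kripke structure on the set of worlds `W`. -/
structure Kripke (W : Type u) where
  R : W → W → Prop
  V : W → Set ℕ

/-- `M.Models w a`: the formula `a` is true at the world `w` of `M`. -/
def Kripke.Models {W : Type u} (M : Kripke W) : W → Modal → Prop
  | _, .top => True
  | w, .letter p => p ∈ M.V w
  | w, .neg a => ¬ M.Models w a
  | w, .or a b => M.Models w a ∨ M.Models w b
  | w, .dia a => ∃ v, M.R w v ∧ M.Models v a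
  | w, .box a => ∀ v, M.R w v → M.Models v a

/-- The four logics. -/
inductive Logic : Type
  | K : Logic
  | T : Logic
  | K4 : Logic
  | S4 : Logic

namespace Logic

/-- The logics of reflexive frames. -/
def isRefl : Logic → Bool
  | K => false
  | T => true
  | K4 => false
  | S4 => true

/-- The logics of transitive frames. -/
def isTrans : Logic → Bool
  | K => false
  | T => false
  | K4 => true
  | S4 => true

/-- The frame class of a logic: all frames, the reflexive, the transitive, and the reflexive and
transitive ones. -/
def Frame (Λ : Logic) {W : Type u} (R : W → W → Prop) : Prop :=
  (Λ.isRefl = true → ∀ w, R w w) ∧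
    (Λ.isTrans = true → ∀ w v x, R w v → R v x → R w x)

end Logic

/-- Satisfiability of a modal formula in a logic. -/
def Modal.Satisfiable (Λ : Logic) (a : Modal) : Prop :=
  ∃ (W : Type u) (M : Kripke W) (w : W), Λ.Frame M.R ∧ M.Models w a

/-! ### The Horn box fragment -/

/-- Positive literals of the box fragment: `λ ::= ⊤ | p | □ λ`. -/
inductive BoxLit : Type
  | top : BoxLit
  | letter (p : ℕ) : BoxLit
  | box (l : BoxLit) : BoxLit
  deriving DecidableEq

/-- The formulas that the procedure manipulates, that is, literals, implications
`λ₁ ∧ … ∧ λₙ → λ` (with head `none` for `λ₁ ∧ … ∧ λₙ → ⊥`), and boxes of such formulas. -/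
inductive Form : Type
  | top : Form
  | letter (p : ℕ) : Form
  | box (ψ : Form) : Form
  | rule (body : List BoxLit) (head : Option BoxLit) : Form
  deriving DecidableEq

def BoxLit.toForm : BoxLit → Form
  | .top => .top
  | .letter p => .letter p
  | .box l => .box l.toForm

def BoxLit.toModal : BoxLit → Modal
  | .top => .top
  | .letter p => .letter p
  | .box l => .box l.toModal

namespace Form

def toModal : Form → Modal
  | top => .top
  | letter p => .letter p
  | box ψ => .box ψ.toModal
  | rule body none => .imp (.bigAnd (body.map BoxLit.toModal)) .bot
  | rule body (some l) => .imp (.bigAnd (body.map BoxLit.toModal)) l.toModal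

def length (ψ : Form) : ℕ := ψ.toModal.length

/-- The subformulas of a formula. Partial conjunctions and negations inside an implication are left
out: they are never boxed and never labels, so the procedure does not meet them. -/
def closure : Form → Finset Form
  | top => {top}
  | letter p => {letter p}
  | box ψ => insert (box ψ) ψ.closure
  | rule body head =>
      insert (rule body head)
        ((body ++ head.toList).toFinset.biUnion fun l => closureLit l)
where
  closureLit : BoxLit → Finset Form
  | .top => {top}
  | .letter p => {letter p}
  | .box l => insert (box l.toForm) (closureLit l)

/-- Is the formula a positive literal? -/
def isLit : Form → Bool
  | top => true
  | letter _ => true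
  | box ψ => ψ.isLit
  | rule _ _ => false

/-- Is the formula a positive literal of the form `□λ`? -/
def isBoxedLit : Form → Bool
  | box ψ => ψ.isLit
  | _ => false

end Form

/-- A Horn box clause `□ ⋯ □ (λ₁ ∧ … ∧ λₙ → λ)` with `boxes` leading boxes; the head `none` stands
for `⊥`. -/
structure Clause : Type where
  boxes : ℕ
  body : List BoxLit
  head : Option BoxLit

def Clause.toForm (c : Clause) : Form := Form.box^[c.boxes] (.rule c.body c.head)

/-- A Horn box formula: a conjunction of Horn box clauses, given by the list of its conjuncts. -/
abbrev HornBoxFormula : Type := List Clause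

namespace HornBoxFormula

def toModal (φ : HornBoxFormula) : Modal := .bigAnd (φ.map fun c => c.toForm.toModal)

/-- `|φ|`, the number of symbols of `φ`. -/
def length (φ : HornBoxFormula) : ℕ := (toModal φ).length

/-- `md(φ)`. -/
def depth (φ : HornBoxFormula) : ℕ := (toModal φ).depth

/-- The set of the conjuncts `φ₁, …, φₗ`. -/
def clauses (φ : HornBoxFormula) : Finset Form := (φ.map Clause.toForm).toFinset

/-- `Cl(φ)`. -/
def Cl (φ : HornBoxFormula) : Finset Form := (clauses φ).biUnion Form.closure

/-- Satisfiability of `φ` in a logic. -/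
def Satisfiable (Λ : Logic) (φ : HornBoxFormula) : Prop := Modal.Satisfiable.{u} Λ (toModal φ)

end HornBoxFormula

/-! ### The procedure -/

/-- The structure `(W, H, L)` with `W = {w₀, …, w_{size - 1}}`: `H` labels a world with the
formulas to be analysed and `L` with formulas that hold there. -/
@[ext]
structure State : Type where
  size : ℕ
  H : ℕ → Finset Form
  L : ℕ → Finset Form

namespace State

/-- All the formulas that label the world `w_k`: `H(w_k) ∪ L(w_k)`. -/
def label (S : State) (k : ℕ) : Finset Form := S.H k ∪ S.L k

/-- `H(w_k) ← H(w_k) ∪ A`. -/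
def addH (S : State) (k : ℕ) (A : Finset Form) : State :=
  { S with H := Function.update S.H k (S.H k ∪ A) }

/-- `H(w_k) ← H(w_k) \ {ψ}` and `L(w_k) ← L(w_k) ∪ {ψ}`. -/
def move (S : State) (k : ℕ) (ψ : Form) : State :=
  { S with
    H := Function.update S.H k ((S.H k).erase ψ)
    L := Function.update S.L k (insert ψ (S.L k)) }

/-- Add a new last world, with `H = ∅` and `L = {⊤}`. -/
def addWorld (S : State) : State :=
  { size := S.size + 1
    H := Function.update S.H S.size ∅
    L := Function.update S.L S.size {.top} }

/-- Keep only the worlds `w_i` with `i < k`. -/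
def restrict (S : State) (k : ℕ) : State :=
  { size := k
    H := fun i => if i < k then S.H i else ∅
    L := fun i => if i < k then S.L i else ∅ }

/-- The initial structure: one world, with `H(w₀) = {φ₁, …, φₗ}` and `L(w₀) = {⊤}`. -/
def init (φ : HornBoxFormula) : State :=
  { size := 1
    H := fun i => if i = 0 then HornBoxFormula.clauses φ else ∅
    L := fun i => if i = 0 then {.top} else ∅ }

/-- Going from `S` to `S'` changes the labelling of some world. -/
def Changes (S S' : State) : Prop := ∃ i, S'.label i ≠ S.label i ∨ S'.L i ≠ S.L i

end State

/-- The bound `N` on the index of the worlds. -/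
def bound (Λ : Logic) (φ : HornBoxFormula) : ℕ :=
  if Λ.isTrans then HornBoxFormula.length φ else HornBoxFormula.depth φ

/-- The self-loop rule for the last possible world `w_N`, in the transitive logics: `□ψ` holds there
if `ψ` does. -/
def loopRule (Λ : Logic) (φ : HornBoxFormula) (k : ℕ) (ψ : Form) (S : State) : State :=
  if Λ.isTrans = true ∧ k = bound Λ φ ∧ ψ.box ∈ HornBoxFormula.Cl φ then S.addH k {ψ.box} else S

/-- The propagation of `□ψ` to the predecessor of `w_k`, where `ψ` holds: it requires `□ψ` at `w_k`
in the transitive logics, and `ψ` at `w_{k-1}` in the reflexive ones. -/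
def backRule (Λ : Logic) (φ : HornBoxFormula) (k : ℕ) (ψ : Form) (S : State) : State :=
  if 0 < k ∧ ψ.box ∈ HornBoxFormula.Cl φ ∧ (Λ.isTrans = true → ψ.box ∈ S.label k) ∧
      (Λ.isRefl = true → ψ ∈ S.label (k - 1)) then
    S.addH (k - 1) {ψ.box}
  else S

/-- The treatment of `ψ` at `w_k` according to its form; `none` means that the saturation procedure
returns False. -/
def analyse (Λ : Logic) (k : ℕ) (S : State) : Form → Option State
  | .top => some S
  | .letter p => some (S.move k (.letter p))
  | .box ξ =>
      let S' := if Λ.isRefl = true then S.addH k {ξ} else S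
      if k + 1 < S.size then
        some ((S'.move k (.box ξ)).addH (k + 1) (if Λ.isTrans = true then {ξ, .box ξ} else {ξ}))
      else some S'
  | .rule body (some l) =>
      if ∀ b ∈ body, b.toForm ∈ S.label k then
        some ((S.addH k {l.toForm}).move k (.rule body (some l)))
      else some S
  | .rule body none =>
      if ∀ b ∈ body, b.toForm ∈ S.label k then none else some S

/-- The body of the while loop of the saturation procedure of the logic `Λ`, for the chosen world
`w_k` and formula `ψ`. -/
def iteration (Λ : Logic) (φ : HornBoxFormula) (k : ℕ) (ψ : Form) (S : State) : Option State :=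
  analyse Λ k (backRule Λ φ k ψ (loopRule Λ φ k ψ S)) ψ

/-- No choice of `w_k` and `ψ` has an effect any more. -/
def Saturated (Λ : Logic) (φ : HornBoxFormula) (S : State) : Prop :=
  ∀ k < S.size, ∀ ψ ∈ S.label k, ∃ S', iteration Λ φ k ψ S = some S' ∧ ¬ S.Changes S'

/-- The set `B = {□λ | □λ ∈ Cl(φ)}`, where `λ` ranges over positive literals. -/
def boxesOf (φ : HornBoxFormula) : Finset Form :=
  (HornBoxFormula.Cl φ).filter fun χ => χ.isBoxedLit = true

/-! ### Elementary costs

The labelling of a world is stored as a list of the formulas of `Cl(φ) ∪ {⊤}`, each with two marks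
(in `H`, in `L`), the worlds form a list, and two formulas are compared symbol by symbol. -/

/-- Reaching a world and looking up, marking or unmarking the formula `ψ` there. -/
def lookupCost (φ : HornBoxFormula) (S : State) (ψ : Form) : ℕ :=
  S.size + 1 + ∑ χ ∈ insert .top (HornBoxFormula.Cl φ), (χ.length + ψ.length)

/-- An upper bound on the cost of trying one iteration of the while loop for the formula `ψ`: at most
six operations on `□ψ`, four on `ψ`, two on `ξ` if `ψ = □ξ`, and one on each literal of `ψ` if `ψ`
is an implication. -/
def tryCost (φ : HornBoxFormula) (S : State) (ψ : Form) : ℕ :=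
  6 * lookupCost φ S ψ.box + 4 * lookupCost φ S ψ +
    match ψ with
    | .top => 0
    | .letter _ => 0
    | .box ξ => 2 * lookupCost φ S ξ
    | .rule body head => ((body ++ head.toList).map fun l => lookupCost φ S l.toForm).sum

/-- Evaluating the condition of the while loop by trying all worlds and formulas, and performing
an iteration. -/
def searchCost (φ : HornBoxFormula) (S : State) : ℕ :=
  1 + ∑ k ∈ Finset.range S.size, ∑ ψ ∈ S.label k, (1 + tryCost φ S ψ)

/-- Computing `N` and the list of the formulas of `Cl(φ)`, and building the initial structure:
each of the at most `|φ|` occurrences of subformulas is compared with the list. -/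
def initCost (φ : HornBoxFormula) : ℕ :=
  HornBoxFormula.length φ *
    (1 + ∑ χ ∈ insert .top (HornBoxFormula.Cl φ), (χ.length + HornBoxFormula.length φ))

/-- Adding an unmarked world at the end, or deleting the last world. -/
def worldCost (φ : HornBoxFormula) (S : State) : ℕ :=
  S.size + 2 + (HornBoxFormula.Cl φ).card

/-- Adding `B` to a label. -/
def boxesCost (φ : HornBoxFormula) (S : State) : ℕ :=
  ∑ χ ∈ HornBoxFormula.Cl φ, (χ.length + lookupCost φ S χ)

/-! ### Execution -/

/-- The place from which the saturation procedure was called. -/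
inductive Caller : Type
  | main : Caller
  | shorten : Caller

/-- Control states of the procedure. In `saturate c j S` the index `j` is the current value of the
loop variable of the caller. -/
inductive Config : Type
  | start : Config
  | main (d : ℕ) (S : State) : Config
  | shorten (k : ℕ) (S : State) : Config
  | saturate (c : Caller) (j : ℕ) (S : State) : Config
  | halted (answer : Bool) : Config

/-- `Step Λ φ c t c'`: the procedure, run on the logic `Λ` and the formula `φ`, can go from `c` to
`c'` in one step, namely one iteration of one of its loops or one call or return; the step consists
of at most `t` elementary operations. The choice of the world and of the formula in the while loop is
free among those that have an effect; a formula that was already moved to `L` may be chosen again,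
since the rules for `□ψ` look at labels that can grow later. -/
inductive Step (Λ : Logic) (φ : HornBoxFormula) : Config → ℕ → Config → Prop
  | init : Step Λ φ .start (initCost φ) (.main 0 (.init φ))
  | mainCall (d : ℕ) (S : State) : d ≤ bound Λ φ →
      Step Λ φ (.main d S) 1 (.saturate .main d S)
  | mainEnd (d : ℕ) (S : State) : bound Λ φ < d →
      Step Λ φ (.main d S) 1 (.halted true)
  | iterate (c : Caller) (j : ℕ) (S S' : State) (k : ℕ) (ψ : Form) : k < S.size → ψ ∈ S.label k →
      iteration Λ φ k ψ S = some S' → S.Changes S' →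
      Step Λ φ (.saturate c j S) (searchCost φ S) (.saturate c j S')
  | mainTrue (d : ℕ) (S : State) : Saturated Λ φ S →
      Step Λ φ (.saturate .main d S) (searchCost φ S + worldCost φ S) (.main (d + 1) S.addWorld)
  | mainFalse (d : ℕ) (S : State) (k : ℕ) (ψ : Form) : k < S.size → ψ ∈ S.label k →
      iteration Λ φ k ψ S = none →
      Step Λ φ (.saturate .main d S) (searchCost φ S) (.shorten d S)
  | shortenCall (k : ℕ) (S : State) : 1 ≤ k →
      Step Λ φ (.shorten k S) (worldCost φ S + boxesCost φ S)
        (.saturate .shorten k ((S.restrict k).addH (k - 1) (boxesOf φ)))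
  | shortenEnd (S : State) : Step Λ φ (.shorten 0 S) 1 (.halted false)
  | shortenTrue (k : ℕ) (S : State) : Saturated Λ φ S →
      Step Λ φ (.saturate .shorten k S) (searchCost φ S) (.halted true)
  | shortenFalse (j : ℕ) (S : State) (k : ℕ) (ψ : Form) : k < S.size → ψ ∈ S.label k →
      iteration Λ φ k ψ S = none →
      Step Λ φ (.saturate .shorten j S) (searchCost φ S) (.shorten (j - 1) S)

/-- `Reaches Λ φ n t c`: some execution of the procedure on `Λ` and `φ` reaches `c` after `n` steps,
which consist of `t` elementary operations. -/
inductive Reaches (Λ : Logic) (φ : HornBoxFormula) : ℕ → ℕ → Config → Prop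
  | start : Reaches Λ φ 0 0 .start
  | step {n t s : ℕ} {c c' : Config} :
      Reaches Λ φ n t c → Step Λ φ c s c' → Reaches Λ φ (n + 1) (t + s) c'

end HornBox

namespace HornBox

/-! ### Formulas, their truth, and their length -/

/-! The notion that carries the proof is `Closed`: a labelling of the chain `w_0, …, w_(n-1)` that
is stable under all rules of Saturate except those with head `⊥`. An iteration adds only formulas
that closedness forces (`Closed.label_iteration`), so the labels of the main loop lie in every
closed labelling that contains the initial data (`Minimal`). Conversely a saturated labelling is
itself closed (`Saturated.closed`). The main loop thus computes a least closed labelling, whatever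
choices are made.

If `φ` holds at `w` in a model, the sets of formulas true at all worlds exactly `i` steps away from
`w` form a closed labelling (`Kripke.closed_theory`). A False answer of Saturate at `w_k` therefore
means that no world is `k` steps away. Hence all boxes hold vacuously at distance `k - 1`, which
justifies what Shorten adds. Since `w` itself is at distance `0`, Shorten cannot run through to its
end, and the answer is True.

A True answer must come with a model: the chain itself, where a letter holds when it is a label
(`satisfiable_of_labelling`). The delicate point is its last world. After Shorten, that world has
every boxed literal and needs no successor. After the main loop without transitivity, comparison
with a closed labelling by modal depth shows that no box matters there. With transitivity, the last
world sees itself; the labels increase from `w_1` on inside a set of at most `|φ|` formulas, so they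
either stabilise or become everything, and both make the loop harmless
(`Saturated.mem_last_of_box_mem`).

For the complexity, each effective iteration increases `State.weight`, and each deletion by Shorten
costs at most `2|φ|` of it. The potential `stepBound` turns this into a quadratic bound on the
number of steps; each step costs `O(|φ|^5)`. -/

theorem Kripke.models_and {W : Type u} (M : Kripke W) (w : W) (a b : Modal) :
    M.Models w (a.and b) ↔ M.Models w a ∧ M.Models w b := by
  simp only [Modal.and, Kripke.Models]; tauto

theorem Kripke.models_bigAnd {W : Type u} (M : Kripke W) (w : W) (l : List Modal) :
    M.Models w (.bigAnd l) ↔ ∀ a ∈ l, M.Models w a := by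
  induction l with
  | nil => simp [Modal.bigAnd, Kripke.Models]
  | cons a l ih =>
    cases l with
    | nil => simp [Modal.bigAnd]
    | cons b l => rw [Modal.bigAnd, models_and, ih, List.forall_mem_cons (a := a)]

theorem Kripke.models_rule_some {W : Type u} (M : Kripke W) (w : W) (body : List BoxLit)
    (l : BoxLit) : M.Models w (Form.rule body (some l)).toModal ↔
      ((∀ b ∈ body, M.Models w b.toModal) → M.Models w l.toModal) := by
  simp only [Form.toModal, Modal.imp, Kripke.Models, models_bigAnd, List.forall_mem_map]
  tauto

theorem Kripke.models_rule_none {W : Type u} (M : Kripke W) (w : W) (body : List BoxLit) :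
    M.Models w (Form.rule body none).toModal ↔ ¬ ∀ b ∈ body, M.Models w b.toModal := by
  simp only [Form.toModal, Modal.imp, Modal.bot, Kripke.Models, models_bigAnd, List.forall_mem_map]
  tauto

theorem BoxLit.toModal_toForm (l : BoxLit) : l.toForm.toModal = l.toModal := by
  induction l <;> simp [toForm, toModal, Form.toModal, *]

theorem Form.closureLit_eq (l : BoxLit) : closure.closureLit l = l.toForm.closure := by
  induction l <;> simp [closure.closureLit, BoxLit.toForm, closure, *]

theorem Form.mem_closure_self (ψ : Form) : ψ ∈ ψ.closure := by
  cases ψ <;> simp [closure]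

theorem BoxLit.closure_trans (l : BoxLit) {χ : Form} (h : χ ∈ l.toForm.closure) :
    χ.closure ⊆ l.toForm.closure := by
  induction l with
  | top => simp_all [toForm, Form.closure]
  | letter p => simp_all [toForm, Form.closure]
  | box l ih =>
    simp only [toForm, Form.closure, Finset.mem_insert] at h ⊢
    rcases h with rfl | h
    · simp [Form.closure]
    · exact (ih h).trans (Finset.subset_insert _ _)

theorem Form.closure_trans {ψ χ : Form} (h : χ ∈ ψ.closure) : χ.closure ⊆ ψ.closure := by
  induction ψ with
  | top => simp_all [Form.closure]
  | letter p => simp_all [Form.closure]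
  | box ψ ih =>
    simp only [closure, Finset.mem_insert] at h ⊢
    rcases h with rfl | h
    · simp [Form.closure]
    · exact (ih h).trans (Finset.subset_insert _ _)
  | rule body head =>
    rw [closure, Finset.mem_insert] at h
    rcases h with rfl | h
    · exact subset_rfl
    · rw [Finset.mem_biUnion] at h
      obtain ⟨l, hl, h⟩ := h
      rw [closureLit_eq] at h
      refine (l.closure_trans h).trans fun x hx => ?_
      rw [closure, Finset.mem_insert, Finset.mem_biUnion]
      exact .inr ⟨l, hl, by rwa [closureLit_eq]⟩

namespace HornBoxFormula

variable {φ : HornBoxFormula}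

theorem closure_subset_Cl {ψ : Form} (h : ψ ∈ Cl φ) : ψ.closure ⊆ Cl φ := by
  rw [Cl, Finset.mem_biUnion] at h
  obtain ⟨c, hc, h⟩ := h
  intro x hx
  rw [Cl, Finset.mem_biUnion]
  exact ⟨c, hc, Form.closure_trans h hx⟩

theorem clauses_subset_Cl : clauses φ ⊆ Cl φ := fun c hc => by
  rw [Cl, Finset.mem_biUnion]
  exact ⟨c, hc, c.mem_closure_self⟩

theorem mem_Cl_of_box {ψ : Form} (h : ψ.box ∈ Cl φ) : ψ ∈ Cl φ :=
  closure_subset_Cl h (by simp [Form.closure, Form.mem_closure_self])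

theorem mem_Cl_of_rule {body : List BoxLit} {head : Option BoxLit} {l : BoxLit}
    (h : Form.rule body head ∈ Cl φ) (hl : l ∈ body ++ head.toList) : l.toForm ∈ Cl φ := by
  refine closure_subset_Cl h ?_
  rw [Form.closure, Finset.mem_insert, Finset.mem_biUnion]
  exact .inr ⟨l, by simpa using hl, by rw [Form.closureLit_eq]; exact Form.mem_closure_self _⟩

theorem models_toModal {W : Type u} (M : Kripke W) (w : W) :
    M.Models w (toModal φ) ↔ ∀ ψ ∈ clauses φ, M.Models w ψ.toModal := by
  simp [toModal, Kripke.models_bigAnd, clauses]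

end HornBoxFormula

theorem Modal.length_pos (a : Modal) : 0 < a.length := by
  cases a <;> simp [length]

theorem Modal.sum_length_le_bigAnd (l : List Modal) :
    (l.map length).sum ≤ (bigAnd l).length := by
  induction l with
  | nil => simp
  | cons a l ih =>
    cases l with
    | nil => simp [bigAnd]
    | cons b l =>
      rw [bigAnd, List.map_cons, List.sum_cons, Modal.and]
      simp only [length]; omega

theorem Modal.depth_le_length (a : Modal) : a.depth ≤ a.length := by
  induction a <;> simp [depth, length] <;> omega

theorem Modal.depth_le_bigAnd {l : List Modal} {a : Modal} (h : a ∈ l) :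
    a.depth ≤ (bigAnd l).depth := by
  induction l with
  | nil => simp at h
  | cons b l ih =>
    cases l with
    | nil => simp_all [bigAnd]
    | cons c l =>
      rw [bigAnd, Modal.and]
      simp only [depth]
      rcases List.mem_cons.1 h with rfl | h
      · exact le_max_left _ _
      · exact (ih h).trans (le_max_right _ _)

theorem Modal.length_le_bigAnd {l : List Modal} {a : Modal} (h : a ∈ l) :
    a.length ≤ (bigAnd l).length :=
  (List.single_le_sum (fun _ _ => Nat.zero_le _) _ (List.mem_map_of_mem h)).trans
    (sum_length_le_bigAnd l)

/-! ### Sizes -/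

theorem BoxLit.card_closure_le (l : BoxLit) : l.toForm.closure.card ≤ l.toModal.length := by
  induction l with
  | top => simp [toForm, Form.closure, toModal, Modal.length]
  | letter p => simp [toForm, Form.closure, toModal, Modal.length]
  | box l ih =>
    simp only [toForm, Form.closure, toModal, Modal.length]
    exact (Finset.card_insert_le _ _).trans (by omega)

theorem Form.sum_length_lt_rule (body : List BoxLit) (head : Option BoxLit) :
    ((body ++ head.toList).map fun l => l.toModal.length).sum + 2 ≤ (rule body head).length := by
  have h := Modal.sum_length_le_bigAnd (body.map BoxLit.toModal)
  rw [List.map_map] at h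
  cases head with
  | none =>
    simp only [Form.length, toModal, Modal.imp, Modal.length, Option.toList, List.append_nil]
    simp only [Function.comp_def] at h; omega
  | some l =>
    simp only [Form.length, toModal, Modal.imp, Modal.length, Option.toList, List.map_append,
      List.sum_append, List.map_cons, List.map_nil, List.sum_singleton]
    simp only [Function.comp_def] at h; omega

/-- An implication contributes one new subformula, but its encoding as a disjunction with a negation
contributes two symbols. The strictness leaves room for `⊤` in `card_insert_Cl_le`. -/
theorem Form.card_closure_rule_lt (body : List BoxLit) (head : Option BoxLit) :
    (rule body head).closure.card < (rule body head).length := by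
  have h1 : (rule body head).closure.card ≤
      ((body ++ head.toList).map fun l => l.toModal.length).sum + 1 := by
    rw [closure]
    refine (Finset.card_insert_le _ _).trans (Nat.add_le_add_right ?_ 1)
    refine Finset.card_biUnion_le.trans ?_
    generalize body ++ head.toList = L
    induction L with
    | nil => simp
    | cons a L ih =>
      rw [List.toFinset_cons, List.map_cons, List.sum_cons]
      refine le_trans ?_ (Nat.add_le_add (BoxLit.card_closure_le a) ih)
      rw [← closureLit_eq]
      by_cases ha : a ∈ L.toFinset
      · rw [Finset.insert_eq_of_mem ha]; omega
      · rw [Finset.sum_insert ha]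
  have := sum_length_lt_rule body head
  omega

theorem Clause.card_closure_lt (c : Clause) : c.toForm.closure.card < c.toForm.length := by
  unfold toForm
  induction c.boxes with
  | zero => exact Form.card_closure_rule_lt _ _
  | succ n ih =>
    rw [Function.iterate_succ_apply']
    simp only [Form.closure, Form.length, Form.toModal, Modal.length] at ih ⊢
    exact (Finset.card_insert_le _ _).trans_lt (by omega)

theorem BoxLit.length_le_of_mem_closure {l : BoxLit} {χ : Form} (h : χ ∈ l.toForm.closure) :
    χ.length ≤ l.toForm.length := by
  induction l with
  | top => simp_all [toForm, Form.closure]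
  | letter p => simp_all [toForm, Form.closure]
  | box l ih =>
    simp only [toForm, Form.closure, Finset.mem_insert] at h ⊢
    rcases h with rfl | h
    · exact le_rfl
    · exact (ih h).trans (by simp [Form.length, Form.toModal, Modal.length])

theorem Form.length_le_of_mem_closure {ψ χ : Form} (h : χ ∈ ψ.closure) :
    χ.length ≤ ψ.length := by
  induction ψ with
  | top => simp_all [Form.closure]
  | letter p => simp_all [Form.closure]
  | box ψ ih =>
    simp only [closure, Finset.mem_insert] at h ⊢
    rcases h with rfl | h
    · exact le_rfl
    · exact (ih h).trans (by simp [Form.length, Form.toModal, Modal.length])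
  | rule body head =>
    rw [closure, Finset.mem_insert] at h
    rcases h with rfl | h
    · exact le_rfl
    · rw [Finset.mem_biUnion] at h
      obtain ⟨l, hl, h⟩ := h
      rw [closureLit_eq] at h
      refine (BoxLit.length_le_of_mem_closure h).trans ?_
      have h1 := sum_length_lt_rule body head
      have h2 : l.toModal.length ≤ ((body ++ head.toList).map fun l => l.toModal.length).sum :=
        List.single_le_sum (fun _ _ => Nat.zero_le _) _
          (List.mem_map_of_mem (f := fun l : BoxLit => l.toModal.length) (List.mem_toFinset.1 hl))
      rw [Form.length, BoxLit.toModal_toForm]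
      omega

namespace HornBoxFormula

variable {φ : HornBoxFormula}

theorem length_pos (φ : HornBoxFormula) : 0 < length φ := Modal.length_pos _

/-- Every clause has at least one symbol to spare, and one spare symbol pays for `⊤`. The bound has
to be exactly `|φ|`, because the pigeonhole argument for the transitive logics runs on a chain with
`N = |φ|`. -/
theorem card_insert_Cl_le (φ : HornBoxFormula) : (insert .top (Cl φ)).card ≤ length φ := by
  refine (Finset.card_insert_le _ _).trans ?_
  by_cases hφ : φ = []
  · subst hφ; simp [Cl, clauses, length, toModal, Modal.bigAnd, Modal.length]
  have h1 : (Cl φ).card + List.length φ ≤ ((φ.map fun c => c.toForm.toModal).map Modal.length).sum := by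
    rw [Cl, clauses]
    refine (Nat.add_le_add_right Finset.card_biUnion_le _).trans ?_
    clear hφ
    induction φ with
    | nil => simp
    | cons a L ih =>
      have ha := a.card_closure_lt
      rw [Form.length] at ha
      simp only [List.map_cons, List.toFinset_cons, List.sum_cons, List.length_cons]
      by_cases hm : a.toForm ∈ (L.map Clause.toForm).toFinset
      · rw [Finset.insert_eq_of_mem hm]; omega
      · rw [Finset.sum_insert hm]; omega
  have h2 := Modal.sum_length_le_bigAnd (φ.map fun c => c.toForm.toModal)
  have h3 := List.length_pos_iff.2 hφ
  rw [length, toModal]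
  omega

theorem length_le_of_mem {ψ : Form} (h : ψ ∈ insert .top (Cl φ)) : ψ.length ≤ length φ := by
  rcases Finset.mem_insert.1 h with rfl | h
  · exact length_pos φ
  · rw [Cl, Finset.mem_biUnion] at h
    obtain ⟨c, hc, h⟩ := h
    refine (Form.length_le_of_mem_closure h).trans ?_
    rw [clauses, List.mem_toFinset, List.mem_map] at hc
    obtain ⟨a, ha, rfl⟩ := hc
    exact Modal.length_le_bigAnd (List.mem_map_of_mem ha)

theorem depth_le_of_mem_clauses {ψ : Form} (h : ψ ∈ clauses φ) : ψ.toModal.depth ≤ depth φ := by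
  rw [clauses, List.mem_toFinset, List.mem_map] at h
  obtain ⟨a, ha, rfl⟩ := h
  exact Modal.depth_le_bigAnd (List.mem_map_of_mem ha)

end HornBoxFormula

theorem Form.depth_body_le {body : List BoxLit} {head : Option BoxLit} {b : BoxLit}
    (h : b ∈ body) : b.toModal.depth ≤ (rule body head).toModal.depth := by
  have := Modal.depth_le_bigAnd (List.mem_map_of_mem (f := BoxLit.toModal) h)
  cases head <;> simp only [toModal, Modal.imp, Modal.depth] <;> exact le_max_of_le_left this

theorem Form.depth_head_le {body : List BoxLit} {l : BoxLit} :
    l.toModal.depth ≤ (rule body (some l)).toModal.depth := by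
  simp only [toModal, Modal.imp, Modal.depth]; exact le_max_right _ _

theorem bound_le_length (Λ : Logic) (φ : HornBoxFormula) : bound Λ φ ≤ φ.length := by
  rw [bound]
  split
  · exact le_rfl
  · exact Modal.depth_le_length _

end HornBox

namespace HornBox

/-! ### Closed labellings -/

namespace State

variable (S : State)

@[simp] theorem move_size (k : ℕ) (ψ : Form) : (S.move k ψ).size = S.size := rfl

theorem mem_label_addH {k i : ℕ} {A : Finset Form} {χ : Form} :
    χ ∈ (S.addH k A).label i ↔ χ ∈ S.label i ∨ i = k ∧ χ ∈ A := by
  by_cases h : i = k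
  · subst h; simp [label, addH]; tauto
  · simp [label, addH, h]

theorem mem_label_move {k i : ℕ} {ψ χ : Form} :
    χ ∈ (S.move k ψ).label i ↔ χ ∈ S.label i ∨ i = k ∧ χ = ψ := by
  by_cases h : i = k
  · subst h; simp [label, move]; tauto
  · simp [label, move, h]

theorem mem_L_move {k i : ℕ} {ψ χ : Form} :
    χ ∈ (S.move k ψ).L i ↔ χ ∈ S.L i ∨ i = k ∧ χ = ψ := by
  by_cases h : i = k
  · subst h; simp [move]; tauto
  · simp [move, h]

/-- `S'` has the worlds of `S` and at least its labels. -/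
structure Le (S S' : State) : Prop where
  size : S'.size = S.size
  label : ∀ i, S.label i ⊆ S'.label i
  L : ∀ i, S.L i ⊆ S'.L i
  label_ge : ∀ i, S.size ≤ i → S'.label i = S.label i
  L_ge : ∀ i, S.size ≤ i → S'.L i = S.L i

variable {S}

theorem Le.refl : Le S S :=
  ⟨rfl, fun _ => subset_rfl, fun _ => subset_rfl, fun _ _ => rfl, fun _ _ => rfl⟩

theorem Le.trans {S' S'' : State} (h : Le S S') (h' : Le S' S'') : Le S S'' :=
  ⟨h'.size.trans h.size, fun i => (h.label i).trans (h'.label i), fun i => (h.L i).trans (h'.L i),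
    fun i hi => (h'.label_ge i (h.size ▸ hi)).trans (h.label_ge i hi),
    fun i hi => (h'.L_ge i (h.size ▸ hi)).trans (h.L_ge i hi)⟩

theorem le_addH {k : ℕ} (A : Finset Form) (hk : k < S.size) : Le S (S.addH k A) := by
  refine ⟨rfl, fun i χ h => S.mem_label_addH.2 (.inl h), fun i => subset_rfl, fun i hi => ?_,
    fun i _ => rfl⟩
  ext χ
  rw [mem_label_addH]
  exact ⟨fun h => h.resolve_right fun h => by omega, .inl⟩

theorem le_move {k : ℕ} (ψ : Form) (hk : k < S.size) : Le S (S.move k ψ) := by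
  refine ⟨rfl, fun i χ h => S.mem_label_move.2 (.inl h), fun i χ h => S.mem_L_move.2 (.inl h),
    fun i hi => ?_, fun i hi => ?_⟩
  · ext χ
    rw [mem_label_move]
    exact ⟨fun h => h.resolve_right fun h => by omega, .inl⟩
  · ext χ
    rw [mem_L_move]
    exact ⟨fun h => h.resolve_right fun h => by omega, .inl⟩

end State

/-- The labelling `B` of the worlds `w_i`, `i < n`, is closed under the rules of the saturation
procedure, except for those with head `⊥`. -/
structure Closed (Λ : Logic) (φ : HornBoxFormula) (n : ℕ) (B : ℕ → Set Form) : Prop where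
  loop : ∀ ψ, bound Λ φ < n → Λ.isTrans = true → ψ ∈ B (bound Λ φ) →
    ψ.box ∈ HornBoxFormula.Cl φ → ψ.box ∈ B (bound Λ φ)
  back : ∀ k ψ, k + 1 < n → ψ ∈ B (k + 1) → ψ.box ∈ HornBoxFormula.Cl φ →
    (Λ.isTrans = true → ψ.box ∈ B (k + 1)) → (Λ.isRefl = true → ψ ∈ B k) → ψ.box ∈ B k
  refl : ∀ k ψ, k < n → Λ.isRefl = true → Form.box ψ ∈ B k → ψ ∈ B k
  next : ∀ k ψ, k + 1 < n → Form.box ψ ∈ B k → ψ ∈ B (k + 1)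
  trans : ∀ k ψ, k + 1 < n → Λ.isTrans = true → Form.box ψ ∈ B k → ψ.box ∈ B (k + 1)
  rule : ∀ k body l, k < n → Form.rule body (some l) ∈ B k → (∀ b ∈ body, b.toForm ∈ B k) →
    l.toForm ∈ B k

/-! ### One iteration only adds labels, and only forced ones -/

section

variable {Λ : Logic} {φ : HornBoxFormula} {k : ℕ} {ψ : Form} {S S' : State}

theorem le_loopRule (hk : k < S.size) : S.Le (loopRule Λ φ k ψ S) := by
  rw [loopRule]
  split
  · exact State.le_addH _ hk
  · exact .refl

theorem le_backRule (hk : k < S.size) : S.Le (backRule Λ φ k ψ S) := by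
  rw [backRule]
  split
  · exact State.le_addH _ (by omega)
  · exact .refl

theorem le_analyse (hk : k < S.size) (h : analyse Λ k S ψ = some S') : S.Le S' := by
  cases ψ with
  | top => cases h; exact .refl
  | letter p => cases h; exact State.le_move _ hk
  | box ξ =>
    simp only [analyse] at h
    have h1 : S.Le (if Λ.isRefl = true then S.addH k {ξ} else S) := by
      split
      · exact State.le_addH _ hk
      · exact .refl
    split at h
    · cases h
      refine h1.trans ((State.le_move _ (h1.size ▸ hk)).trans (State.le_addH _ ?_))
      rw [State.move_size, h1.size]; assumption
    · cases h; exact h1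
  | rule body head =>
    cases head with
    | none =>
      simp only [analyse] at h
      split at h
      · cases h
      · cases h; exact .refl
    | some l =>
      simp only [analyse] at h
      split at h
      · cases h
        exact (State.le_addH _ hk).trans (State.le_move _ hk)
      · cases h; exact .refl

theorem le_iteration (hk : k < S.size) (h : iteration Λ φ k ψ S = some S') : S.Le S' := by
  have h1 : S.Le (loopRule Λ φ k ψ S) := le_loopRule hk
  have h2 := h1.trans (le_backRule (Λ := Λ) (φ := φ) (ψ := ψ) (h1.size ▸ hk))
  exact h2.trans (le_analyse (h2.size ▸ hk) h)

/-- The labels that one operation produces stay in every closed labelling. -/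
theorem Closed.label_loopRule {B : ℕ → Set Form} (hB : Closed Λ φ S.size B) (hk : k < S.size)
    (hψ : ψ ∈ B k) (hS : ∀ i < S.size, ∀ χ ∈ S.label i, χ ∈ B i) :
    ∀ i < S.size, ∀ χ ∈ (loopRule Λ φ k ψ S).label i, χ ∈ B i := by
  intro i hi χ hχ
  rw [loopRule] at hχ
  split at hχ
  · rename_i h
    obtain ⟨h1, rfl, h3⟩ := h
    rcases S.mem_label_addH.1 hχ with h | ⟨rfl, h⟩
    · exact hS i hi χ h
    · rw [Finset.mem_singleton.1 h]
      exact hB.loop ψ hk h1 hψ h3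
  · exact hS i hi χ hχ

theorem Closed.label_backRule {B : ℕ → Set Form} (hB : Closed Λ φ S.size B) (hk : k < S.size)
    (hψ : ψ ∈ B k) (hS : ∀ i < S.size, ∀ χ ∈ S.label i, χ ∈ B i) :
    ∀ i < S.size, ∀ χ ∈ (backRule Λ φ k ψ S).label i, χ ∈ B i := by
  intro i hi χ hχ
  rw [backRule] at hχ
  split at hχ
  · rename_i h
    obtain ⟨h1, h2, h3, h4⟩ := h
    obtain ⟨k, rfl⟩ := Nat.exists_eq_add_of_lt h1
    simp only [zero_add, Nat.add_sub_cancel] at *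
    rcases S.mem_label_addH.1 hχ with h | ⟨rfl, h⟩
    · exact hS i hi χ h
    · rw [Finset.mem_singleton.1 h]
      exact hB.back _ ψ hk hψ h2 (fun h => hS _ hk _ (h3 h)) (fun h => hS _ hi _ (h4 h))
  · exact hS i hi χ hχ

theorem Closed.label_analyse {B : ℕ → Set Form} (hB : Closed Λ φ S.size B) (hk : k < S.size)
    (hψ : ψ ∈ B k) (hS : ∀ i < S.size, ∀ χ ∈ S.label i, χ ∈ B i)
    (h : analyse Λ k S ψ = some S') : ∀ i < S.size, ∀ χ ∈ S'.label i, χ ∈ B i := by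
  intro i hi χ hχ
  cases ψ with
  | top => cases h; exact hS i hi χ hχ
  | letter p =>
    cases h
    rcases S.mem_label_move.1 hχ with h | ⟨rfl, rfl⟩
    · exact hS i hi χ h
    · exact hψ
  | box ξ =>
    simp only [analyse] at h
    have h1 : ∀ i < S.size, ∀ χ ∈ (if Λ.isRefl = true then S.addH k {ξ} else S).label i,
        χ ∈ B i := by
      intro i hi χ hχ
      split at hχ
      · rcases S.mem_label_addH.1 hχ with h' | ⟨rfl, h'⟩
        · exact hS i hi χ h'
        · rw [Finset.mem_singleton.1 h']
          exact hB.refl _ ξ hk ‹_› hψ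
      · exact hS i hi χ hχ
    split at h
    · cases h
      rcases (State.mem_label_addH _).1 hχ with h | ⟨rfl, h⟩
      · rcases (State.mem_label_move _).1 h with h | ⟨rfl, rfl⟩
        · exact h1 i hi χ h
        · exact hψ
      · split at h
        · rcases Finset.mem_insert.1 h with rfl | h
          · exact hB.next _ _ hi hψ
          · rw [Finset.mem_singleton.1 h]
            exact hB.trans _ _ hi ‹_› hψ
        · rw [Finset.mem_singleton.1 h]
          exact hB.next _ _ hi hψ
    · cases h; exact h1 i hi χ hχ
  | rule body head =>
    cases head with
    | none =>
      simp only [analyse] at h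
      split at h
      · cases h
      · cases h; exact hS i hi χ hχ
    | some l =>
      simp only [analyse] at h
      split at h
      · cases h
        rename_i hb
        rcases (State.mem_label_move _).1 hχ with h | ⟨rfl, rfl⟩
        · rcases S.mem_label_addH.1 h with h' | ⟨rfl, h'⟩
          · exact hS i hi χ h'
          · rw [Finset.mem_singleton.1 h']
            exact hB.rule _ body l hk hψ fun b hbb => hS _ hk _ (hb b hbb)
        · exact hψ
      · cases h; exact hS i hi χ hχ

theorem Closed.label_loopRule_backRule {B : ℕ → Set Form} (hB : Closed Λ φ S.size B)
    (hk : k < S.size) (hψ : ψ ∈ B k) (hS : ∀ i < S.size, ∀ χ ∈ S.label i, χ ∈ B i) :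
    ∀ i < S.size, ∀ χ ∈ (backRule Λ φ k ψ (loopRule Λ φ k ψ S)).label i, χ ∈ B i := by
  have h1 : S.Le (loopRule Λ φ k ψ S) := le_loopRule hk
  rw [← h1.size] at hB ⊢
  exact hB.label_backRule (h1.size ▸ hk) hψ
    (h1.size ▸ (h1.size ▸ hB : Closed Λ φ S.size B).label_loopRule hk hψ hS)

/-- The source of all upper bounds on labels: it is applied to `Cl(φ) ∪ {⊤}`, to the theory of a
model and, through `Minimal`, to labellings built for a purpose. -/
theorem Closed.label_iteration {B : ℕ → Set Form} (hB : Closed Λ φ S.size B) (hk : k < S.size)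
    (hψ : ψ ∈ S.label k) (hS : ∀ i < S.size, ∀ χ ∈ S.label i, χ ∈ B i)
    (h : iteration Λ φ k ψ S = some S') : ∀ i < S'.size, ∀ χ ∈ S'.label i, χ ∈ B i := by
  have h1 : S.Le (loopRule Λ φ k ψ S) := le_loopRule hk
  have h2 := h1.trans (le_backRule (Λ := Λ) (φ := φ) (ψ := ψ) (h1.size ▸ hk))
  have hψ' := hS k hk ψ hψ
  have h3 := hB.label_loopRule_backRule hk hψ' hS
  rw [(le_iteration hk h).size, ← h2.size]
  rw [← h2.size] at h3
  exact (h2.size ▸ hB).label_analyse (h2.size ▸ hk) hψ' h3 h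

/-- If the saturation procedure returns False, then the body of an implication with head `⊥` is in
every closed labelling above the current one. -/
theorem Closed.of_iteration_eq_none {B : ℕ → Set Form} (hB : Closed Λ φ S.size B)
    (hk : k < S.size) (hψ : ψ ∈ S.label k) (hS : ∀ i < S.size, ∀ χ ∈ S.label i, χ ∈ B i)
    (h : iteration Λ φ k ψ S = none) :
    ∃ body, Form.rule body none ∈ B k ∧ ∀ b ∈ body, b.toForm ∈ B k := by
  have hψ' := hS k hk ψ hψ
  have h3 := hB.label_loopRule_backRule hk hψ' hS
  rw [iteration] at h
  cases ψ with
  | top => cases h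
  | letter p => cases h
  | box ξ =>
    simp only [analyse] at h
    split at h <;> cases h
  | rule body head =>
    cases head with
    | none =>
      simp only [analyse] at h
      split at h
      · rename_i hb
        exact ⟨body, hψ', fun b hbb => h3 k hk _ (hb b hbb)⟩
      · cases h
    | some l =>
      simp only [analyse] at h
      split at h <;> cases h

/-! ### Saturated labellings are closed -/

theorem label_eq_of_not_changes (h : ¬ S.Changes S') (i : ℕ) : S'.label i = S.label i := by
  by_contra hi
  exact h ⟨i, .inl hi⟩

/-- Labels only grow during an iteration, so if they agree at its end with those of `S`, they also
agree at every intermediate stage. Each closure condition can then be read off from the operation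
that would enforce it. -/
theorem Saturated.exists_iteration (h : Saturated Λ φ S) (hk : k < S.size) (hψ : ψ ∈ S.label k) :
    (∀ i, (loopRule Λ φ k ψ S).label i = S.label i) ∧
    (∀ i, (backRule Λ φ k ψ (loopRule Λ φ k ψ S)).label i = S.label i) ∧
    ∃ S₁ S', (∀ i, S₁.label i = S.label i) ∧ S₁.size = S.size ∧
      analyse Λ k S₁ ψ = some S' ∧ ∀ i, S'.label i = S.label i := by
  obtain ⟨S', h, hS'⟩ := h k hk ψ hψ
  have h1 : S.Le (loopRule Λ φ k ψ S) := le_loopRule hk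
  have h2 := le_backRule (Λ := Λ) (φ := φ) (ψ := ψ) (h1.size ▸ hk)
  have h3 := le_analyse (by rw [h2.size, h1.size]; exact hk) h
  have h4 := label_eq_of_not_changes hS'
  have h5 : ∀ i, (backRule Λ φ k ψ (loopRule Λ φ k ψ S)).label i = S.label i := fun i =>
    ((h3.label i).trans (h4 i).subset).antisymm ((h1.label i).trans (h2.label i))
  exact ⟨fun i => ((h2.label i).trans (h5 i).subset).antisymm (h1.label i), h5,
    _, S', h5, h2.size.trans h1.size, h, h4⟩

theorem Saturated.closed (h : Saturated Λ φ S) : Closed Λ φ S.size fun i => ↑(S.label i) where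
  loop ψ hk ht hψ hc := by
    obtain ⟨h1, -⟩ := h.exists_iteration hk hψ
    have := h1 (bound Λ φ)
    rw [loopRule, if_pos ⟨ht, rfl, hc⟩] at this
    rw [Finset.mem_coe, ← this, State.mem_label_addH]
    simp
  back k ψ hk hψ hc ht hr := by
    obtain ⟨h1, h2, -⟩ := h.exists_iteration hk hψ
    have := h2 k
    rw [backRule, if_pos] at this
    · rw [Finset.mem_coe, ← this, State.mem_label_addH]
      simp
    · simp only [h1]
      exact ⟨by omega, hc, ht, hr⟩
  refl k ψ hk hr hψ := by
    obtain ⟨-, -, S₁, S', h1, h2, h3, h4⟩ := h.exists_iteration hk hψ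
    simp only [analyse, hr, if_true] at h3
    rw [Finset.mem_coe, ← h4]
    split at h3 <;> cases h3 <;> simp [State.mem_label_addH, State.mem_label_move]
  next k ψ hk hψ := by
    obtain ⟨-, -, S₁, S', h1, h2, h3, h4⟩ := h.exists_iteration (Nat.lt_of_succ_lt hk) hψ
    simp only [analyse, h2, hk, if_true] at h3
    cases h3
    rw [Finset.mem_coe, ← h4, State.mem_label_addH]
    refine .inr ⟨rfl, ?_⟩
    split <;> simp
  trans k ψ hk ht hψ := by
    obtain ⟨-, -, S₁, S', h1, h2, h3, h4⟩ := h.exists_iteration (Nat.lt_of_succ_lt hk) hψ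
    simp only [analyse, h2, hk, ht, if_true] at h3
    cases h3
    rw [Finset.mem_coe, ← h4, State.mem_label_addH]
    exact .inr ⟨rfl, by simp⟩
  rule k body l hk hψ hb := by
    obtain ⟨-, -, S₁, S', h1, h2, h3, h4⟩ := h.exists_iteration hk hψ
    simp only [analyse, h1] at h3
    have hb' : ∀ b ∈ body, b.toForm ∈ S.label k := hb
    rw [if_pos hb'] at h3
    cases h3
    rw [Finset.mem_coe, ← h4, State.mem_label_move, State.mem_label_addH]
    simp

theorem Saturated.not_body_subset (h : Saturated Λ φ S) (hk : k < S.size) {body : List BoxLit}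
    (hψ : Form.rule body none ∈ S.label k) : ¬ ∀ b ∈ body, b.toForm ∈ S.label k := by
  intro hb
  obtain ⟨-, -, S₁, S', h1, h2, h3, h4⟩ := h.exists_iteration hk hψ
  simp only [analyse, h1] at h3
  rw [if_pos hb] at h3
  cases h3

end

end HornBox

namespace HornBox

open HornBoxFormula

/-! ### From saturated labellings to models -/

section

variable {Λ : Logic} {φ : HornBoxFormula} {S S' : State}

theorem BoxLit.isLit_toForm (l : BoxLit) : l.toForm.isLit = true := by
  induction l <;> simp [toForm, Form.isLit, *]

theorem BoxLit.box_toForm_mem_boxesOf {l : BoxLit} (h : l.toForm.box ∈ Cl φ) :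
    l.toForm.box ∈ boxesOf φ := by
  rw [boxesOf, Finset.mem_filter]
  exact ⟨h, l.isLit_toForm⟩

/-- A labelling in which literals behave as in a model on the relation `R` yields a model. The
predicate `P` holds for the literals that matter at a world. -/
theorem satisfiable_of_labelling {R : ℕ → ℕ → Prop} (hR : Λ.Frame R) {A : ℕ → Set Form} {n : ℕ}
    {P : ℕ → BoxLit → Prop} (hRn : ∀ i j, i ≤ n → R i j → j ≤ n)
    (hclauses : ∀ ψ ∈ clauses φ, ψ ∈ A 0) (htop : ∀ i ≤ n, Form.top ∈ A i)
    (hfwd : ∀ i j ξ, i ≤ n → R i j → Form.box ξ ∈ A i → ξ ∈ A j)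
    (hback : ∀ i l, i ≤ n → P i (.box l) → l.toForm.box ∈ Cl φ →
      (∀ j, R i j → l.toForm ∈ A j) → l.toForm.box ∈ A i)
    (hP : ∀ i j l, i ≤ n → R i j → P i (.box l) → P j l)
    (hPrule : ∀ i body head, i ≤ n → Form.rule body head ∈ A i → ∀ b ∈ body, P i b)
    (hCl : ∀ i ≤ n, ∀ ψ ∈ A i, ψ ∈ insert Form.top (Cl φ))
    (hsome : ∀ i body l, i ≤ n → Form.rule body (some l) ∈ A i → (∀ b ∈ body, b.toForm ∈ A i) →
      l.toForm ∈ A i)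
    (hnone : ∀ i body, i ≤ n → Form.rule body none ∈ A i → ¬ ∀ b ∈ body, b.toForm ∈ A i) :
    Satisfiable.{u} Λ φ := by
  -- The worlds are natural numbers, lifted to the universe in which satisfiability is asked for.
  let M : Kripke (ULift.{u} ℕ) := ⟨fun x y => R x.down y.down, fun x => {p | .letter p ∈ A x.down}⟩
  have sound : ∀ (l : BoxLit) (i : ℕ), i ≤ n → l.toForm ∈ A i → M.Models ⟨i⟩ l.toModal := by
    intro l
    induction l with
    | top => intros; trivial
    | letter p => intro i _ h; exact h
    | box l ih => intro i hi h ⟨j⟩ hj; exact ih j (hRn i j hi hj) (hfwd i j _ hi hj h)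
  -- Bodies of implications occur negatively, so for them truth must imply membership. This is where
  -- `hback` is needed, and only for literals that satisfy `P`.
  have complete : ∀ (l : BoxLit) (i : ℕ), i ≤ n → P i l → l.toForm ∈ Cl φ →
      M.Models ⟨i⟩ l.toModal → l.toForm ∈ A i := by
    intro l
    induction l with
    | top => intro i hi _ _ _; exact htop i hi
    | letter p => intro i _ _ _ h; exact h
    | box l ih =>
      intro i hi hPi hl h
      exact hback i l hi hPi hl fun j hj =>
        ih j (hRn i j hi hj) (hP i j l hi hj hPi) (mem_Cl_of_box hl) (h ⟨j⟩ hj)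
  have body_mem : ∀ (i : ℕ) (body : List BoxLit) (head : Option BoxLit), i ≤ n →
      Form.rule body head ∈ A i → (∀ b ∈ body, M.Models ⟨i⟩ b.toModal) →
      ∀ b ∈ body, b.toForm ∈ A i := by
    intro i body head hi h hb b hbb
    have h1 : Form.rule body head ∈ Cl φ := by simpa using hCl i hi _ h
    exact complete b i hi (hPrule i body head hi h b hbb)
      (mem_Cl_of_rule h1 (List.mem_append_left _ hbb)) (hb b hbb)
  have truth : ∀ (ψ : Form) (i : ℕ), i ≤ n → ψ ∈ A i → M.Models ⟨i⟩ ψ.toModal := by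
    intro ψ
    induction ψ with
    | top => intros; trivial
    | letter p => intro i _ h; exact h
    | box ψ ih => intro i hi h ⟨j⟩ hj; exact ih j (hRn i j hi hj) (hfwd i j _ hi hj h)
    | rule body head =>
      intro i hi h
      cases head with
      | none =>
        rw [Kripke.models_rule_none]
        exact fun hb => hnone i body hi h (body_mem i body _ hi h hb)
      | some l =>
        rw [Kripke.models_rule_some]
        exact fun hb => sound l i hi (hsome i body l hi h (body_mem i body _ hi h hb))
  exact ⟨ULift.{u} ℕ, M, ⟨0⟩, ⟨fun h x => hR.1 h x.down, fun h x y z => hR.2 h x.down y.down z.down⟩,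
    (models_toModal M ⟨0⟩).2 fun ψ hψ => truth ψ 0 (Nat.zero_le _) (hclauses ψ hψ)⟩

/-- The accessibility relation of a chain of the worlds `0, …, n` in a logic; in the transitive
logics, `n` is accessible from itself if `loop` holds. -/
def chainRel (Λ : Logic) (n : ℕ) (loop : Prop) (i j : ℕ) : Prop :=
  (Λ.isRefl = true ∧ i = j) ∨
    (j ≤ n ∧ ((Λ.isTrans = true ∧ (i < j ∨ (loop ∧ i = n ∧ j = n))) ∨
      (Λ.isTrans = false ∧ j = i + 1)))

theorem frame_chainRel (Λ : Logic) (n : ℕ) (loop : Prop) : Λ.Frame (chainRel Λ n loop) := by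
  refine ⟨fun h i => .inl ⟨h, rfl⟩, fun h i j k => ?_⟩
  simp only [chainRel, h]
  by_cases hl : loop <;> simp only [hl] <;> grind

theorem chainRel_le {n : ℕ} {loop : Prop} {i j : ℕ} (hi : i ≤ n) (h : chainRel Λ n loop i j) :
    j ≤ n := by
  rcases h with ⟨-, rfl⟩ | ⟨h, -⟩ <;> assumption

theorem chainRel_le_succ (ht : Λ.isTrans = false) {n : ℕ} {loop : Prop} {i j : ℕ}
    (h : chainRel Λ n loop i j) : j ≤ i + 1 := by
  rcases h with ⟨-, rfl⟩ | ⟨-, ⟨h, -⟩ | ⟨-, rfl⟩⟩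
  · omega
  · simp [ht] at h
  · omega

/-- In the transitive logics `□ξ` travels along the chain to the predecessor of `j`, which then
passes `ξ` on; only the loop at `n` needs the extra hypothesis `hl`. -/
theorem Closed.mem_of_box_mem {n : ℕ} {loop : Prop} {A : ℕ → Set Form}
    (hA : Closed Λ φ (n + 1) A) {ξ : Form}
    (hl : loop → Λ.isTrans = true → Form.box ξ ∈ A n → ξ ∈ A n) {i j : ℕ}
    (hi : i ≤ n) (hij : chainRel Λ n loop i j) (h : Form.box ξ ∈ A i) : ξ ∈ A j := by
  rcases hij with ⟨hr, rfl⟩ | ⟨hj, ⟨ht, hij | ⟨hloop, rfl, rfl⟩⟩ | ⟨-, rfl⟩⟩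
  · exact hA.refl _ _ (by omega) hr h
  · have : ∀ m, i + m ≤ n → Form.box ξ ∈ A (i + m) := by
      intro m
      induction m with
      | zero => exact fun _ => h
      | succ m ih => exact fun hm => hA.trans (i + m) ξ (by omega) ht (ih (by omega))
    obtain ⟨m, rfl⟩ := Nat.exists_eq_add_of_lt hij
    exact hA.next (i + m) ξ (by omega) (this m (by omega))
  · exact hl hloop ht h
  · exact hA.next _ _ (by omega) h

/-- In the transitive logics a box moves back to a world only if its successor has it too, so the
induction starts at the last world, where `hlast` supplies the box, and descends to `i`. -/
theorem Closed.box_mem_of_lt {n : ℕ} {loop : Prop} {A : ℕ → Set Form}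
    (hA : Closed Λ φ (n + 1) A) {ξ : Form} (hξ : ξ.box ∈ Cl φ)
    (hlast : Λ.isTrans = true → ξ ∈ A n → ξ.box ∈ A n) {i : ℕ}
    (hi : i < n) (h : ∀ j, chainRel Λ n loop i j → ξ ∈ A j) : ξ.box ∈ A i := by
  cases ht : Λ.isTrans with
  | false =>
    exact hA.back i ξ (by omega) (h _ (.inr ⟨hi, .inr ⟨ht, rfl⟩⟩)) hξ (by simp [ht])
      fun hr => h i (.inl ⟨hr, rfl⟩)
  | true =>
    have h1 : ∀ j, i < j → j ≤ n → ξ ∈ A j := fun j hj hn => h j (.inr ⟨hn, .inl ⟨ht, .inl hj⟩⟩)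
    have h2 : ∀ m, i < n - m → ξ.box ∈ A (n - m) := by
      intro m
      induction m with
      | zero => exact fun _ => hlast ht (h1 n hi le_rfl)
      | succ m ih =>
        intro hm
        have e : n - (m + 1) + 1 = n - m := by omega
        exact hA.back _ ξ (by omega) (e ▸ h1 _ (by omega) (by omega)) hξ
          (fun _ => e ▸ ih (by omega)) fun _ => h1 _ hm (by omega)
    have e : n - (n - i - 1) = i + 1 := by omega
    exact hA.back i ξ (by omega) (h1 _ (by omega) (by omega)) hξ
      (fun _ => e ▸ h2 (n - i - 1) (by omega)) fun hr => h i (.inl ⟨hr, rfl⟩)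

/-- The labels contain what they must, and only formulas of `Cl(φ) ∪ {⊤}`. -/
structure Labelled (φ : HornBoxFormula) (S : State) : Prop where
  clauses : ∀ ψ ∈ clauses φ, ψ ∈ S.label 0
  top : ∀ i < S.size, Form.top ∈ S.label i
  Cl : ∀ i < S.size, ∀ ψ ∈ S.label i, ψ ∈ insert Form.top (Cl φ)

/-- The labelling is contained in every closed labelling. -/
def Minimal (Λ : Logic) (φ : HornBoxFormula) (S : State) : Prop :=
  ∀ B : ℕ → Set Form, Closed Λ φ S.size B → (∀ ψ ∈ clauses φ, ψ ∈ B 0) →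
    (∀ i < S.size, Form.top ∈ B i) → ∀ i < S.size, ∀ χ ∈ S.label i, χ ∈ B i

/-- The chain gets no loop at `n` beyond reflexivity. The last world has all boxed literals, so the
backward condition is automatic there. -/
theorem Saturated.satisfiable_of_boxesOf {n : ℕ} (h : Saturated Λ φ S) (hS : Labelled φ S)
    (hn : S.size = n + 1) (hbox : boxesOf φ ⊆ S.label n) : Satisfiable.{u} Λ φ := by
  have hA := hn ▸ h.closed
  refine satisfiable_of_labelling (A := fun i => ↑(S.label i)) (P := fun _ _ => True)
    (frame_chainRel Λ n False) (fun i j => chainRel_le) hS.clauses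
    (fun i hi => hS.top i (by omega)) (fun i j ξ hi hij => hA.mem_of_box_mem (by simp) hi hij)
    ?_ (fun _ _ _ _ _ _ => trivial) (fun _ _ _ _ _ _ _ => trivial) (fun i hi => hS.Cl i (by omega))
    (fun i body l hi => hA.rule i body l (by omega))
    (fun i body hi hb => h.not_body_subset (by omega) hb)
  intro i l hi _ hl hj
  have h1 : l.toForm.box ∈ S.label n := hbox (l.box_toForm_mem_boxesOf hl)
  rcases hi.lt_or_eq with hi | rfl
  · exact hA.box_mem_of_lt hl (fun _ _ => h1) hi hj
  · exact h1

/-- A labelling that bounds the modal depth is closed in the logics without transitivity. -/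
theorem closed_depth (ht : Λ.isTrans = false) :
    Closed Λ φ (bound Λ φ + 1) fun i => {ψ | ψ.toModal.depth + i ≤ bound Λ φ} where
  loop ψ _ h := by simp [ht] at h
  back k ψ _ h _ _ _ := by simp only [Set.mem_ofPred_eq, Form.toModal, Modal.depth] at *; omega
  refl k ψ _ _ h := by simp only [Set.mem_ofPred_eq, Form.toModal, Modal.depth] at *; omega
  next k ψ _ h := by simp only [Set.mem_ofPred_eq, Form.toModal, Modal.depth] at *; omega
  trans k ψ _ h := by simp [ht] at h
  rule k body l _ h _ := by
    have := Form.depth_head_le (body := body) (l := l)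
    rw [Set.mem_ofPred_eq, BoxLit.toModal_toForm]
    rw [Set.mem_ofPred_eq] at h
    omega

theorem Saturated.satisfiable_of_isTrans_eq_false (ht : Λ.isTrans = false) (h : Saturated Λ φ S)
    (hS : Labelled φ S) (hn : S.size = bound Λ φ + 1) (hmin : Minimal Λ φ S) :
    Satisfiable.{u} Λ φ := by
  have hA := hn ▸ h.closed
  have hd : ∀ i ≤ bound Λ φ, ∀ ψ ∈ S.label i, ψ.toModal.depth + i ≤ bound Λ φ := by
    intro i hi ψ hψ
    refine hmin _ (hn ▸ closed_depth ht) (fun χ hχ => ?_) (fun i hi => ?_) i (by omega) ψ hψ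
    · have := depth_le_of_mem_clauses hχ
      simp only [bound, ht]
      simpa using this
    · simp only [Set.mem_ofPred_eq, Form.toModal, Modal.depth]; omega
  refine satisfiable_of_labelling (A := fun i => ↑(S.label i))
    (P := fun i l => l.toModal.depth + i ≤ bound Λ φ)
    (frame_chainRel Λ (bound Λ φ) True) (fun i j => chainRel_le) hS.clauses
    (fun i hi => hS.top i (by omega))
    (fun i j ξ hi hij => hA.mem_of_box_mem (by simp [ht]) hi hij)
    ?_ ?_ ?_ (fun i hi => hS.Cl i (by omega))
    (fun i body l hi => hA.rule i body l (by omega))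
    (fun i body hi hb => h.not_body_subset (by omega) hb)
  · intro i l hi hP hl hj
    simp only [BoxLit.toModal, Modal.depth] at hP
    -- A boxed literal within the depth bound forces `i < N`, so the last world never has to acquire
    -- a box.
    exact hA.box_mem_of_lt hl (by simp [ht]) (by omega) hj
  · intro i j l hi hij hP
    have := chainRel_le_succ ht hij
    simp only [BoxLit.toModal, Modal.depth] at hP
    omega
  · intro i body head hi hb b hbb
    have := Form.depth_body_le (head := head) hbb
    have := hd i hi _ hb
    omega

/-- By minimality it suffices that the formulas of `w_i` that persist at `w_(i+1)` form a closed
labelling: transitivity repeats at each world what it received from its predecessor. The world `w_0`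
is exempt, since the clauses are put only there. -/
theorem Saturated.label_subset_succ (ht : Λ.isTrans = true) (h : Saturated Λ φ S)
    (hS : Labelled φ S) (hmin : Minimal Λ φ S) {i : ℕ} (hi : 1 ≤ i) (hi' : i + 1 < S.size) :
    S.label i ⊆ S.label (i + 1) := by
  have hA := h.closed
  have hB : Closed Λ φ S.size
      fun i => {ψ | ψ ∈ S.label i ∧ (1 ≤ i → i + 1 < S.size → ψ ∈ S.label (i + 1))} :=
    { loop := fun ψ hk _ hψ hc => by
        have h1 := hA.loop ψ hk ht hψ.1 hc
        exact ⟨h1, fun _ hk => hA.trans _ _ hk ht h1⟩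
      back := fun k ψ hk hψ hc hb hr =>
        ⟨hA.back k ψ hk hψ.1 hc (fun ht => (hb ht).1) (fun hr' => (hr hr').1),
          fun _ _ => (hb ht).1⟩
      refl := fun k ψ hk hr hψ => ⟨hA.refl k ψ hk hr hψ.1, fun _ h2 => hA.next k ψ h2 hψ.1⟩
      next := fun k ψ hk hψ => ⟨hA.next k ψ hk hψ.1,
        fun _ h2 => hA.next _ ψ h2 (hA.trans k ψ hk ht hψ.1)⟩
      trans := fun k ψ hk _ hψ => ⟨hA.trans k ψ hk ht hψ.1,
        fun _ h2 => hA.trans _ ψ h2 ht (hA.trans k ψ hk ht hψ.1)⟩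
      rule := fun k body l hk hψ hb => ⟨hA.rule k body l hk hψ.1 fun b hbb => (hb b hbb).1,
        fun h1 h2 => hA.rule _ body l h2 (hψ.2 h1 h2) fun b hbb => (hb b hbb).2 h1 h2⟩ }
  intro ψ hψ
  exact (hmin _ hB (fun χ hχ => ⟨hS.clauses χ hχ, by omega⟩)
    (fun j hj => ⟨hS.top j hj, fun _ h2 => hS.top _ h2⟩) i (by omega) ψ hψ).2 hi hi'

/-- In the transitive logics the labels become constant before the last world, unless they
contain all the formulas there. -/
theorem Saturated.mem_last_of_box_mem (ht : Λ.isTrans = true) (h : Saturated Λ φ S)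
    (hS : Labelled φ S) (hn : S.size = bound Λ φ + 1) (hmin : Minimal Λ φ S) {ξ : Form}
    (hξ : ξ.box ∈ S.label (bound Λ φ)) : ξ ∈ S.label (bound Λ φ) := by
  have hA := h.closed
  have hN : bound Λ φ = length φ := by simp [bound, ht]
  have hpos := length_pos φ
  have hmono : ∀ i j, 1 ≤ i → i ≤ j → j ≤ bound Λ φ → S.label i ⊆ S.label j := by
    intro i j hi hij
    induction j, hij using Nat.le_induction with
    | base => exact fun _ => subset_rfl
    | succ j hj ih =>
      exact fun hj' => (ih (by omega)).trans
        (h.label_subset_succ ht hS hmin (by omega) (by omega))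
  by_cases hex : ∃ i, 1 ≤ i ∧ i < bound Λ φ ∧ S.label (i + 1) ⊆ S.label i
  · obtain ⟨i, hi, hiN, hsub⟩ := hex
    -- The self-loop rule creates `□ψ` at the last world, and it moves back to `w_i` because `ψ` is
    -- in all the labels from `i` on.
    have down : ∀ ψ, ψ ∈ S.label i → ψ.box ∈ Cl φ → ψ.box ∈ S.label i := by
      intro ψ hψ hc
      refine hA.back i ψ (by omega) (hmono i _ hi (by omega) (by omega) hψ) hc (fun _ => ?_)
        fun _ => hψ
      have h2 : ∀ m, i < bound Λ φ - m → ψ.box ∈ S.label (bound Λ φ - m) := by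
        intro m
        induction m with
        | zero =>
          exact fun _ => hA.loop ψ (by omega) ht (hmono i _ hi (by omega) le_rfl hψ) hc
        | succ m ih =>
          intro hm
          have e : bound Λ φ - (m + 1) + 1 = bound Λ φ - m := by omega
          exact hA.back _ ψ (by omega) (hmono i _ hi (by omega) (by omega) hψ) hc
            (fun _ => e ▸ ih (by omega)) fun _ => hmono i _ hi (by omega) (by omega) hψ
      have e : bound Λ φ - (bound Λ φ - i - 1) = i + 1 := by omega
      exact e ▸ h2 (bound Λ φ - i - 1) (by omega)
    -- Freezing the labels from the stable index `i` on gives a closed labelling, so by minimality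
    -- the last label is contained in that of `w_i`.
    have hB : Closed Λ φ S.size fun j => ↑(S.label (min j i)) := by
      refine ⟨fun ψ hk _ hψ hc => ?_, fun k ψ hk hψ hc hb hr => ?_, fun k ψ hk hr hψ => ?_,
        fun k ψ hk hψ => ?_, fun k ψ hk _ hψ => ?_, fun k body l hk hψ hb => ?_⟩
      · rw [min_eq_right hiN.le] at hψ ⊢
        exact down ψ hψ hc
      · rcases lt_or_ge k i with hki | hki
        · rw [min_eq_left hki] at hψ hb
          rw [min_eq_left hki.le] at hr ⊢
          exact hA.back k ψ hk hψ hc hb hr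
        · rw [min_eq_right (by omega)] at hψ ⊢
          exact down ψ hψ hc
      · exact hA.refl _ ψ (by omega) hr hψ
      · rcases lt_or_ge k i with hki | hki
        · rw [min_eq_left hki]
          rw [min_eq_left hki.le] at hψ
          exact hA.next k ψ hk hψ
        · rw [min_eq_right (by omega)] at hψ ⊢
          exact hsub (hA.next i ψ (by omega) hψ)
      · rcases lt_or_ge k i with hki | hki
        · rw [min_eq_left hki]
          rw [min_eq_left hki.le] at hψ
          exact hA.trans k ψ hk ht hψ
        · rw [min_eq_right (by omega)] at hψ ⊢
          exact hψ
      · exact hA.rule _ body l (by omega) hψ hb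
    have h1 : ξ.box ∈ S.label i := by
      have := hmin _ hB (by simpa using hS.clauses) (fun j hj => hS.top _ (by omega)) (bound Λ φ)
        (by omega) _ hξ
      rwa [min_eq_right hiN.le] at this
    exact hmono i _ hi (by omega) le_rfl (hsub (hA.next i ξ (by omega) h1))
  · push Not at hex
    -- Without a stable index the labels grow strictly, so the last one has at least `N = |φ|`
    -- elements and must be all of `Cl(φ) ∪ {⊤}`.
    have hcard : ∀ m, 1 ≤ m → m ≤ bound Λ φ → m ≤ (S.label m).card := by
      intro m hm
      induction m, hm using Nat.le_induction with
      | base => exact fun _ => Finset.card_pos.2 ⟨_, hS.top 1 (by omega)⟩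
      | succ m hm ih =>
        intro hm'
        have := Finset.card_lt_card (Finset.ssubset_iff_subset_ne.2
          ⟨hmono m (m + 1) hm (by omega) hm', fun e => hex m hm hm' e.symm.subset⟩)
        have := ih (by omega)
        omega
    have hsub : S.label (bound Λ φ) ⊆ insert .top (Cl φ) := hS.Cl _ (by omega)
    have heq := Finset.eq_of_subset_of_card_le hsub
      ((card_insert_Cl_le φ).trans (hN ▸ hcard (bound Λ φ) (by omega) le_rfl))
    rw [heq] at hξ ⊢
    simp only [Finset.mem_insert, reduceCtorEq, false_or] at hξ
    exact Finset.mem_insert_of_mem (mem_Cl_of_box hξ)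

theorem Saturated.satisfiable_of_isTrans (ht : Λ.isTrans = true) (h : Saturated Λ φ S)
    (hS : Labelled φ S) (hn : S.size = bound Λ φ + 1) (hmin : Minimal Λ φ S) :
    Satisfiable.{u} Λ φ := by
  have hA := hn ▸ h.closed
  have hlast : ∀ ψ : Form, ψ.box ∈ Cl φ → ψ ∈ S.label (bound Λ φ) →
      ψ.box ∈ S.label (bound Λ φ) := fun ψ hc hψ => hA.loop ψ (by omega) ht hψ hc
  refine satisfiable_of_labelling (A := fun i => ↑(S.label i)) (P := fun _ _ => True)
    (frame_chainRel Λ (bound Λ φ) True) (fun i j => chainRel_le) hS.clauses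
    (fun i hi => hS.top i (by omega))
    (fun i j ξ hi hij => hA.mem_of_box_mem
      (fun _ _ => h.mem_last_of_box_mem ht hS hn hmin) hi hij)
    ?_ (fun _ _ _ _ _ _ => trivial) (fun _ _ _ _ _ _ _ => trivial) (fun i hi => hS.Cl i (by omega))
    (fun i body l hi => hA.rule i body l (by omega))
    (fun i body hi hb => h.not_body_subset (by omega) hb)
  intro i l hi _ hl hj
  rcases hi.lt_or_eq with hi | rfl
  · exact hA.box_mem_of_lt hl (fun _ => hlast _ hl) hi hj
  · exact hlast _ hl (hj _ (.inr ⟨le_rfl, .inl ⟨ht, .inr ⟨trivial, rfl, rfl⟩⟩⟩))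

theorem Saturated.satisfiable (h : Saturated Λ φ S) (hS : Labelled φ S)
    (hn : S.size = bound Λ φ + 1) (hmin : Minimal Λ φ S) : Satisfiable.{u} Λ φ := by
  cases ht : Λ.isTrans with
  | false => exact h.satisfiable_of_isTrans_eq_false ht hS hn hmin
  | true => exact h.satisfiable_of_isTrans ht hS hn hmin

end

end HornBox

namespace HornBox

open HornBoxFormula

/-! ### Invariants of the execution -/

section

variable {Λ : Logic} {φ : HornBoxFormula} {S S' : State}

namespace State

theorem mem_label_init {i : ℕ} {χ : Form} :
    χ ∈ (init φ).label i ↔ i = 0 ∧ (χ ∈ clauses φ ∨ χ = .top) := by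
  by_cases h : i = 0 <;> simp [label, init, h, or_comm]

theorem mem_label_addWorld {i : ℕ} {χ : Form} (h : χ ∈ S.addWorld.label i) :
    i ≠ S.size ∧ χ ∈ S.label i ∨ χ = .top := by
  by_cases h' : i = S.size
  · subst h'
    simp [label, addWorld] at h
    exact .inr h
  · refine .inl ⟨h', ?_⟩
    simpa [label, addWorld, h'] using h

theorem label_addWorld_of_lt {i : ℕ} (h : i < S.size) : S.addWorld.label i = S.label i := by
  simp [label, addWorld, h.ne]

theorem L_addWorld_of_lt {i : ℕ} (h : i < S.size) : S.addWorld.L i = S.L i := by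
  simp [addWorld, h.ne]

theorem top_mem_label_addWorld : Form.top ∈ S.addWorld.label S.size := by
  simp [label, addWorld]

theorem label_restrict_of_lt {i k : ℕ} (h : i < k) : (S.restrict k).label i = S.label i := by
  simp [label, restrict, h]

theorem L_restrict_of_lt {i k : ℕ} (h : i < k) : (S.restrict k).L i = S.L i := by
  simp [restrict, h]

end State

theorem Closed.of_succ {n : ℕ} {B : ℕ → Set Form} (h : Closed Λ φ (n + 1) B) :
    Closed Λ φ n B :=
  ⟨fun ψ hk => h.loop ψ (by omega), fun k ψ hk => h.back k ψ (by omega),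
    fun k ψ hk => h.refl k ψ (by omega), fun k ψ hk => h.next k ψ (by omega),
    fun k ψ hk => h.trans k ψ (by omega), fun k body l hk => h.rule k body l (by omega)⟩

/-- Closedness of this constant labelling is the subformula property: no iteration leaves `Cl(φ) ∪
{⊤}`. -/
theorem closed_Cl (Λ : Logic) (φ : HornBoxFormula) (n : ℕ) :
    Closed Λ φ n fun _ => {ψ | ψ ∈ insert Form.top (Cl φ)} := by
  have hb : ∀ ψ : Form, ψ.box ∈ insert Form.top (Cl φ) → ψ ∈ insert Form.top (Cl φ) :=
    fun ψ h => Finset.mem_insert_of_mem (mem_Cl_of_box (by simpa using h))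
  refine ⟨fun ψ _ _ _ h => Finset.mem_insert_of_mem h,
    fun k ψ _ _ h _ _ => Finset.mem_insert_of_mem h, fun k ψ _ _ h => hb ψ h,
    fun k ψ _ h => hb ψ h, fun k ψ _ _ h => h, fun k body l _ h _ => ?_⟩
  have h' : Form.rule body (some l) ∈ Cl φ := by simpa using h
  exact Finset.mem_insert_of_mem (mem_Cl_of_rule h' (by simp))

theorem Labelled.iteration {k : ℕ} {ψ : Form} (hS : Labelled φ S) (hk : k < S.size)
    (hψ : ψ ∈ S.label k) (h : iteration Λ φ k ψ S = some S') : Labelled φ S' where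
  clauses χ hχ := (le_iteration hk h).label 0 (hS.clauses χ hχ)
  top i hi := (le_iteration hk h).label i (hS.top i ((le_iteration hk h).size ▸ hi))
  Cl := (closed_Cl Λ φ S.size).label_iteration hk hψ hS.Cl h

theorem Minimal.iteration {k : ℕ} {ψ : Form} (hS : Minimal Λ φ S) (hk : k < S.size)
    (hψ : ψ ∈ S.label k) (h : iteration Λ φ k ψ S = some S') : Minimal Λ φ S' := by
  intro B hB hc ht
  have hs := (le_iteration hk h).size
  rw [hs] at hB ht
  exact hB.label_iteration hk hψ (hS B hB hc ht) h

theorem labelled_init : Labelled φ (.init φ) where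
  clauses χ hχ := State.mem_label_init.2 ⟨rfl, .inl hχ⟩
  top i hi := State.mem_label_init.2 ⟨by simpa [State.init] using hi, .inr rfl⟩
  Cl i _ χ hχ := by
    rcases (State.mem_label_init.1 hχ).2 with h | rfl
    · exact Finset.mem_insert_of_mem (clauses_subset_Cl h)
    · exact Finset.mem_insert_self _ _

theorem minimal_init : Minimal Λ φ (.init φ) := by
  intro B _ hc ht i hi χ hχ
  obtain ⟨rfl, h | rfl⟩ := State.mem_label_init.1 hχ
  · exact hc χ h
  · exact ht 0 hi

theorem Labelled.addWorld (hS : Labelled φ S) (h0 : 0 < S.size) : Labelled φ S.addWorld where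
  clauses χ hχ := by rw [State.label_addWorld_of_lt h0]; exact hS.clauses χ hχ
  top i hi := by
    rcases (Nat.lt_succ_iff.1 hi).lt_or_eq with h | rfl
    · rw [State.label_addWorld_of_lt h]; exact hS.top i h
    · exact State.top_mem_label_addWorld
  Cl i hi χ hχ := by
    rcases State.mem_label_addWorld hχ with ⟨h, h'⟩ | rfl
    · exact hS.Cl i (lt_of_le_of_ne (Nat.lt_succ_iff.1 hi) h) χ h'
    · exact Finset.mem_insert_self _ _

theorem Minimal.addWorld (hS : Minimal Λ φ S) : Minimal Λ φ S.addWorld := by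
  intro B hB hc ht i hi χ hχ
  rcases State.mem_label_addWorld hχ with ⟨h, h'⟩ | rfl
  · exact hS B hB.of_succ hc (fun j hj => ht j (Nat.lt_succ_of_lt hj)) i
      (lt_of_le_of_ne (Nat.lt_succ_iff.1 hi) h) χ h'
  · exact ht i hi

theorem boxesOf_subset_Cl : boxesOf φ ⊆ Cl φ := Finset.filter_subset _ _

theorem Labelled.restrict_addH {k : ℕ} (hS : Labelled φ S) (hk : 1 ≤ k) (hk' : k < S.size) :
    Labelled φ ((S.restrict k).addH (k - 1) (boxesOf φ)) where
  clauses χ hχ := by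
    rw [State.mem_label_addH, State.label_restrict_of_lt hk]
    exact .inl (hS.clauses χ hχ)
  top i hi := by
    have hi : i < k := hi
    rw [State.mem_label_addH, State.label_restrict_of_lt hi]
    exact .inl (hS.top i (by omega))
  Cl i hi χ hχ := by
    have hi : i < k := hi
    rw [State.mem_label_addH, State.label_restrict_of_lt hi] at hχ
    rcases hχ with h | ⟨-, h⟩
    · exact hS.Cl i (by omega) χ h
    · exact Finset.mem_insert_of_mem (boxesOf_subset_Cl h)

/-- What holds of every configuration that the procedure reaches. -/
def Invariant (Λ : Logic) (φ : HornBoxFormula) : Config → Prop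
  | .start => True
  | .main d S => S.size = d + 1 ∧ d ≤ bound Λ φ + 1 ∧ Labelled φ S ∧ Minimal Λ φ S ∧
      (bound Λ φ < d → Satisfiable.{u} Λ φ)
  | .saturate .main d S => S.size = d + 1 ∧ d ≤ bound Λ φ ∧ Labelled φ S ∧ Minimal Λ φ S
  | .shorten k S => S.size = k + 1 ∧ k ≤ bound Λ φ ∧ Labelled φ S
  | .saturate .shorten k S => S.size = k ∧ 1 ≤ k ∧ k ≤ bound Λ φ ∧ Labelled φ S ∧
      boxesOf φ ⊆ S.label (k - 1)
  | .halted answer => answer = true → Satisfiable.{u} Λ φ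

theorem Invariant.step {c c' : Config} {t : ℕ} (hc : Invariant.{u} Λ φ c)
    (h : Step Λ φ c t c') : Invariant.{u} Λ φ c' := by
  cases h with
  | init => exact ⟨rfl, by omega, labelled_init, minimal_init, by omega⟩
  | mainCall d S hd => exact ⟨hc.1, hd, hc.2.2.1, hc.2.2.2.1⟩
  | mainEnd d S hd => exact fun _ => hc.2.2.2.2 hd
  | iterate c j S S' k ψ hk hψ hS' _ =>
    have hs := (le_iteration hk hS').size
    cases c with
    | main =>
      obtain ⟨h1, h2, h3, h4⟩ := hc
      exact ⟨hs.trans h1, h2, h3.iteration hk hψ hS', h4.iteration hk hψ hS'⟩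
    | shorten =>
      obtain ⟨h1, h2, h3, h4, h5⟩ := hc
      exact ⟨hs.trans h1, h2, h3, h4.iteration hk hψ hS',
        h5.trans ((le_iteration hk hS').label _)⟩
  | mainTrue d S hS =>
    obtain ⟨h1, h2, h3, h4⟩ := hc
    refine ⟨congrArg (· + 1) h1, by omega, h3.addWorld (by omega), h4.addWorld, fun h => ?_⟩
    -- The model comes from `S`, whose last world is `w_N` when `d = N`, before the surplus world is
    -- added.
    exact hS.satisfiable h3 (by omega) h4
  | mainFalse d S k ψ hk hψ hS => exact ⟨hc.1, hc.2.1, hc.2.2.1⟩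
  | shortenCall k S hk =>
    obtain ⟨h1, h2, h3⟩ := hc
    refine ⟨rfl, hk, h2, h3.restrict_addH hk (by omega), fun χ hχ => ?_⟩
    exact (State.mem_label_addH _).2 (.inr ⟨rfl, hχ⟩)
  | shortenEnd S => exact fun h => by cases h
  | shortenTrue k S hS =>
    obtain ⟨h1, h2, h3, h4, h5⟩ := hc
    -- Minimality is lost once Shorten adds unforced boxes; the presence of `boxesOf φ` at the last
    -- world replaces it.
    exact fun _ => hS.satisfiable_of_boxesOf (n := k - 1) h4 (by omega) h5
  | shortenFalse j S k ψ hk hψ hS =>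
    obtain ⟨h1, h2, h3, h4, h5⟩ := hc
    exact ⟨by omega, by omega, h4⟩

theorem Reaches.invariant {c : Config} {n t : ℕ} (h : Reaches Λ φ n t c) :
    Invariant.{u} Λ φ c := by
  induction h with
  | start => trivial
  | step _ hs ih => exact ih.step hs

/-! ### The answer on satisfiable formulas -/

/-- The worlds of `M` that are accessible from `w` in exactly `i` steps. -/
def Kripke.reach {W : Type u} (M : Kripke W) (w : W) : ℕ → Set W
  | 0 => {w}
  | i + 1 => {v | ∃ x ∈ M.reach w i, M.R x v}

/-- The formulas that are true at all the worlds that are accessible from `w` in `i` steps. -/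
def Kripke.theory {W : Type u} (M : Kripke W) (w : W) (i : ℕ) : Set Form :=
  {ψ | ∀ v ∈ M.reach w i, M.Models v ψ.toModal}

theorem Kripke.reach_eq_empty_of_le {W : Type u} (M : Kripke W) (w : W) {i j : ℕ} (hij : i ≤ j)
    (h : M.reach w i = ∅) : M.reach w j = ∅ := by
  induction j, hij using Nat.le_induction with
  | base => exact h
  | succ j _ ih => simp [reach, ih]

theorem Kripke.closed_theory {W : Type u} (M : Kripke W) (w : W) (hM : Λ.Frame M.R) (n : ℕ) :
    Closed Λ φ n (M.theory w) where
  loop ψ _ ht hψ _ v hv x hx := by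
    -- As `N > 0`, a world `N` steps away has a predecessor on its path. By transitivity that
    -- predecessor also sees its successors, which are thus again `N` steps away.
    obtain ⟨m, hm⟩ : ∃ m, bound Λ φ = m + 1 :=
      Nat.exists_eq_succ_of_ne_zero (by rw [bound, if_pos ht]; exact (length_pos φ).ne')
    rw [hm] at hv hψ
    obtain ⟨y, hy, hyv⟩ := hv
    exact hψ x ⟨y, hy, hM.2 ht _ _ _ hyv hx⟩
  back k ψ _ hψ _ _ _ v hv x hx := hψ x ⟨v, hv, hx⟩
  refl k ψ _ hr hψ v hv := hψ v hv v (hM.1 hr v)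
  next k ψ _ hψ := by
    rintro v ⟨x, hx, hxv⟩
    exact hψ x hx v hxv
  trans k ψ _ ht hψ := by
    rintro v ⟨x, hx, hxv⟩ y hy
    exact hψ x hx y (hM.2 ht _ _ _ hxv hy)
  rule k body l _ h hb v hv := by
    rw [BoxLit.toModal_toForm]
    refine (M.models_rule_some v body l).1 (h v hv) fun b hbb => ?_
    rw [← BoxLit.toModal_toForm]
    exact hb b hbb v hv

/-- Any world `k` steps away would satisfy an implication with head `⊥` together with its whole
body. -/
theorem Kripke.reach_eq_empty_of_iteration {W : Type u} {M : Kripke W} {w : W}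
    (hM : Λ.Frame M.R) {k : ℕ} {ψ : Form} (hk : k < S.size) (hψ : ψ ∈ S.label k)
    (hS : ∀ i < S.size, ∀ χ ∈ S.label i, χ ∈ M.theory w i)
    (h : iteration Λ φ k ψ S = none) : M.reach w k = ∅ := by
  obtain ⟨body, h1, h2⟩ := (M.closed_theory w hM S.size).of_iteration_eq_none hk hψ hS h
  rw [Set.eq_empty_iff_forall_notMem]
  intro v hv
  refine (M.models_rule_none v body).1 (h1 v hv) fun b hb => ?_
  rw [← BoxLit.toModal_toForm]
  exact h2 b hb v hv

/-- What holds of every configuration that the procedure reaches if `φ` is true at `w`. -/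
def Sound {W : Type u} (M : Kripke W) (w : W) : Config → Prop
  | .start => True
  | .main _ S => ∀ i < S.size, ∀ χ ∈ S.label i, χ ∈ M.theory w i
  | .saturate .main _ S => ∀ i < S.size, ∀ χ ∈ S.label i, χ ∈ M.theory w i
  | .shorten k S => (∀ i < S.size, ∀ χ ∈ S.label i, χ ∈ M.theory w i) ∧ M.reach w k = ∅
  | .saturate .shorten k S =>
      (∀ i < S.size, ∀ χ ∈ S.label i, χ ∈ M.theory w i) ∧ M.reach w k = ∅
  | .halted answer => answer = true

theorem Sound.step {W : Type u} {M : Kripke W} {w : W} (hM : Λ.Frame M.R)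
    (hw : M.Models w (toModal φ)) {c c' : Config} {t : ℕ} (hc : Sound M w c)
    (hi : Invariant.{u} Λ φ c) (h : Step Λ φ c t c') : Sound M w c' := by
  cases h with
  | init =>
    intro i _ χ hχ
    obtain ⟨rfl, h | rfl⟩ := State.mem_label_init.1 hχ
    · rintro v rfl
      exact (models_toModal M v).1 hw χ h
    · exact fun _ _ => trivial
  | mainCall d S hd => exact hc
  | mainEnd d S hd => exact rfl
  | iterate c j S S' k ψ hk hψ hS' _ =>
    cases c with
    | main => exact (M.closed_theory w hM S.size).label_iteration hk hψ hc hS'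
    | shorten => exact ⟨(M.closed_theory w hM S.size).label_iteration hk hψ hc.1 hS', hc.2⟩
  | mainTrue d S hS =>
    intro i hi χ hχ
    rcases State.mem_label_addWorld hχ with ⟨h, h'⟩ | rfl
    · exact hc i (lt_of_le_of_ne (Nat.lt_succ_iff.1 hi) h) χ h'
    · exact fun _ _ => trivial
  | mainFalse d S k ψ hk hψ hS =>
    have h1 := hi.1
    -- The contradiction may occur at any `w_k` of the chain; emptiness passes on to the last index,
    -- where Shorten starts.
    exact ⟨hc, M.reach_eq_empty_of_le w (by omega)
      (Kripke.reach_eq_empty_of_iteration hM hk hψ hc hS)⟩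
  | shortenCall k S hk =>
    have h1 := hi.1
    refine ⟨fun i hik χ hχ => ?_, hc.2⟩
    have hik : i < k := hik
    rw [State.mem_label_addH, State.label_restrict_of_lt hik] at hχ
    rcases hχ with h | ⟨rfl, h⟩
    · exact hc.1 i (by omega) χ h
    · intro v hv
      rw [boxesOf, Finset.mem_filter] at h
      cases χ with
      | box ξ =>
        intro x hx
        -- A successor would be `k` steps away from `w`, so the added boxes hold vacuously.
        have : x ∈ M.reach w (k - 1 + 1) := ⟨v, hv, hx⟩
        rw [Nat.sub_add_cancel hk, hc.2] at this
        exact this.elim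
      | _ => simp [Form.isBoxedLit] at h
  | shortenEnd S =>
    have : w ∈ M.reach w 0 := rfl
    rw [hc.2] at this
    exact this.elim
  | shortenTrue k S hS => exact rfl
  | shortenFalse j S k ψ hk hψ hS =>
    have h1 := hi.1
    exact ⟨hc.1, M.reach_eq_empty_of_le w (by omega)
      (Kripke.reach_eq_empty_of_iteration hM hk hψ hc.1 hS)⟩

theorem Reaches.sound {W : Type u} {M : Kripke W} {w : W} (hM : Λ.Frame M.R)
    (hw : M.Models w (toModal φ)) {c : Config} {n t : ℕ} (h : Reaches Λ φ n t c) :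
    Sound M w c := by
  induction h with
  | start => trivial
  | step hr hs ih => exact ih.step hM hw hr.invariant hs

/-! ### Progress -/

theorem exists_step_saturate {c : Caller} {j : ℕ}
    (hT : Saturated Λ φ S → ∃ s c', Step Λ φ (.saturate c j S) s c')
    (hF : ∀ k ψ, k < S.size → ψ ∈ S.label k → iteration Λ φ k ψ S = none →
      ∃ s c', Step Λ φ (.saturate c j S) s c') :
    ∃ s c', Step Λ φ (.saturate c j S) s c' := by
  by_cases h : Saturated Λ φ S
  · exact hT h
  · simp only [Saturated] at h
    push Not at h
    obtain ⟨k, hk, ψ, hψ, h⟩ := h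
    cases hS : iteration Λ φ k ψ S with
    | none => exact hF k ψ hk hψ hS
    | some S' => exact ⟨_, _, .iterate c j S S' k ψ hk hψ hS (h S' hS)⟩

theorem halted_or_exists_step (Λ : Logic) (φ : HornBoxFormula) (c : Config) :
    (∃ answer, c = .halted answer) ∨ ∃ s c', Step Λ φ c s c' := by
  cases c with
  | start => exact .inr ⟨_, _, .init⟩
  | main d S =>
    rcases le_or_gt d (bound Λ φ) with h | h
    · exact .inr ⟨_, _, .mainCall d S h⟩
    · exact .inr ⟨_, _, .mainEnd d S h⟩
  | shorten k S =>
    rcases Nat.eq_zero_or_pos k with rfl | h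
    · exact .inr ⟨_, _, .shortenEnd S⟩
    · exact .inr ⟨_, _, .shortenCall k S h⟩
  | saturate c j S =>
    cases c with
    | main => exact .inr (exists_step_saturate (fun h => ⟨_, _, .mainTrue j S h⟩)
        fun k ψ hk hψ h => ⟨_, _, .mainFalse j S k ψ hk hψ h⟩)
    | shorten => exact .inr (exists_step_saturate (fun h => ⟨_, _, .shortenTrue j S h⟩)
        fun k ψ hk hψ h => ⟨_, _, .shortenFalse j S k ψ hk hψ h⟩)
  | halted answer => exact .inl ⟨answer, rfl⟩

/-! ### The number of steps -/

/-- The number of labels, those in `L` counted twice. -/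
def State.weight (S : State) : ℕ :=
  ∑ i ∈ Finset.range S.size, ((S.label i).card + (S.L i).card)

theorem State.L_subset_label (S : State) (i : ℕ) : S.L i ⊆ S.label i :=
  Finset.subset_union_right

theorem State.Le.weight_le (h : S.Le S') : S.weight ≤ S'.weight := by
  rw [State.weight, State.weight, h.size]
  exact Finset.sum_le_sum fun i _ =>
    Nat.add_le_add (Finset.card_le_card (h.label i)) (Finset.card_le_card (h.L i))

/-- Counting `L` a second time makes a mere move from `H` to `L` visible. -/
theorem State.Le.weight_lt (h : S.Le S') (hc : S.Changes S') : S.weight < S'.weight := by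
  obtain ⟨i, hi⟩ := hc
  have his : i < S.size := by
    by_contra hi'
    exact hi.elim (· (h.label_ge i (by omega))) (· (h.L_ge i (by omega)))
  rw [State.weight, State.weight, h.size]
  refine Finset.sum_lt_sum (fun i _ =>
    Nat.add_le_add (Finset.card_le_card (h.label i)) (Finset.card_le_card (h.L i)))
    ⟨i, Finset.mem_range.2 his, ?_⟩
  rcases hi with hi | hi
  · exact Nat.add_lt_add_of_lt_of_le
      (Finset.card_lt_card (Finset.ssubset_iff_subset_ne.2 ⟨h.label i, hi.symm⟩))
      (Finset.card_le_card (h.L i))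
  · exact Nat.add_lt_add_of_le_of_lt (Finset.card_le_card (h.label i))
      (Finset.card_lt_card (Finset.ssubset_iff_subset_ne.2 ⟨h.L i, hi.symm⟩))

theorem Labelled.card_label_le (hS : Labelled φ S) {i : ℕ} (hi : i < S.size) :
    (S.label i).card ≤ length φ :=
  (Finset.card_le_card (hS.Cl i hi)).trans (card_insert_Cl_le φ)

theorem Labelled.card_label_add_le (hS : Labelled φ S) {i : ℕ} (hi : i < S.size) :
    (S.label i).card + (S.L i).card ≤ 2 * length φ := by
  have h1 := hS.card_label_le hi
  have h2 := Finset.card_le_card (S.L_subset_label i)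
  omega

theorem Labelled.weight_le (hS : Labelled φ S) : S.weight ≤ S.size * (2 * length φ) := by
  refine (Finset.sum_le_card_nsmul _ _ _ fun i hi =>
    hS.card_label_add_le (Finset.mem_range.1 hi)).trans ?_
  simp

theorem State.weight_addWorld_ge (S : State) : S.weight ≤ S.addWorld.weight := by
  have h : S.addWorld.size = S.size + 1 := rfl
  rw [State.weight, State.weight, h, Finset.sum_range_succ]
  refine le_add_right (Finset.sum_le_sum fun i hi => ?_)
  rw [label_addWorld_of_lt (Finset.mem_range.1 hi), L_addWorld_of_lt (Finset.mem_range.1 hi)]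

theorem Labelled.weight_le_restrict (hS : Labelled φ S) {k : ℕ} (hk : S.size = k + 1) :
    S.weight ≤ (S.restrict k).weight + 2 * length φ := by
  have h : (S.restrict k).size = k := rfl
  rw [State.weight, State.weight, h, hk, Finset.sum_range_succ]
  refine Nat.add_le_add (Finset.sum_le_sum fun i hi => ?_) (hS.card_label_add_le (by omega))
  rw [State.label_restrict_of_lt (Finset.mem_range.1 hi),
    State.L_restrict_of_lt (Finset.mem_range.1 hi)]

/-- A bound on the number of steps that lead to a configuration. -/
def stepBound (Λ : Logic) (φ : HornBoxFormula) : Config → ℕ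
  | .start => 0
  | .main d S => 1 + 2 * d + S.weight
  | .saturate .main d S => 2 + 2 * d + S.weight
  | .shorten k S =>
      3 + 2 * bound Λ φ + (bound Λ φ - k) * (2 * length φ + 2) + S.weight
  | .saturate .shorten k S =>
      4 + 2 * bound Λ φ + (bound Λ φ - k) * (2 * length φ + 2) + 2 * length φ + S.weight
  | .halted _ => 22 * length φ ^ 2

/-- Configurations that have not halted stay strictly below the value given to halted ones, which
leaves one step for halting. -/
theorem stepBound_le {c : Config} (hc : Invariant.{u} Λ φ c) :
    stepBound Λ φ c + 1 ≤ 22 * length φ ^ 2 + 1 ∧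
      ((∀ b, c ≠ .halted b) → stepBound Λ φ c + 1 ≤ 22 * length φ ^ 2) := by
  have hN := bound_le_length Λ φ
  have hl := length_pos φ
  suffices (∀ b, c ≠ .halted b) → stepBound Λ φ c + 1 ≤ 22 * length φ ^ 2 by
    refine ⟨?_, this⟩
    cases c with
    | halted b => exact le_rfl
    | _ => exact (this (by simp)).trans (by omega)
  intro hb
  have key : ∀ k, (bound Λ φ - k) * (2 * length φ + 2) ≤ length φ * (2 * length φ + 2) :=
    fun k => Nat.mul_le_mul_right _ (by omega)
  have key' : ∀ S, S.size ≤ bound Λ φ + 2 → Labelled φ S →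
      S.weight ≤ (length φ + 2) * (2 * length φ) :=
    fun S hS h => h.weight_le.trans (Nat.mul_le_mul_right _ (by omega))
  cases c with
  | start => simp only [stepBound]; nlinarith
  | main d S =>
    have := key' S (by have := hc.1; have := hc.2.1; omega) hc.2.2.1
    have := hc.2.1
    simp only [stepBound]; nlinarith
  | saturate c j S =>
    cases c with
    | main =>
      have := key' S (by have := hc.1; have := hc.2.1; omega) hc.2.2.1
      have := hc.2.1
      simp only [stepBound]; nlinarith
    | shorten =>
      have := key' S (by have := hc.1; have := hc.2.2.1; omega) hc.2.2.2.1
      have := key j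
      simp only [stepBound]; nlinarith
  | shorten k S =>
    have := key' S (by have := hc.1; have := hc.2.1; omega) hc.2.2
    have := key k
    simp only [stepBound]; nlinarith
  | halted b' => exact (hb b' rfl).elim

/-- The summand 2 per round pays for the call and the return of Saturate; in Shorten a further
`2|φ|` per round makes up for the weight of the deleted world. -/
theorem stepBound_step {c c' : Config} {t : ℕ} (hc : Invariant.{u} Λ φ c)
    (h : Step Λ φ c t c') : stepBound Λ φ c + 1 ≤ stepBound Λ φ c' := by
  have hle := (stepBound_le hc).2
  cases h with
  | init => simp only [stepBound]; omega
  | mainCall d S hd => simp only [stepBound]; omega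
  | mainEnd d S hd => exact hle (by simp)
  | iterate c j S S' k ψ hk hψ hS' hch =>
    have := (le_iteration hk hS').weight_lt hch
    cases c <;> simp only [stepBound] <;> omega
  | mainTrue d S hS =>
    have := S.weight_addWorld_ge
    simp only [stepBound]; omega
  | mainFalse d S k ψ hk hψ hS =>
    have := hc.2.1
    simp only [stepBound]
    have := Nat.zero_le ((bound Λ φ - d) * (2 * length φ + 2))
    omega
  | shortenCall k S hk =>
    have h1 := hc.2.2.weight_le_restrict hc.1
    have h2 := (State.le_addH (S := S.restrict k) (boxesOf φ) (k := k - 1)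
      (show k - 1 < k by omega)).weight_le
    simp only [stepBound]; omega
  | shortenEnd S => exact hle (by simp)
  | shortenTrue k S hS => exact hle (by simp)
  | shortenFalse j S k ψ hk hψ hS =>
    have h1 := hc.2.1
    have h2 := hc.2.2.1
    have e : bound Λ φ - (j - 1) = bound Λ φ - j + 1 := by omega
    simp only [stepBound]
    rw [e, add_one_mul (bound Λ φ - j)]
    omega

theorem Reaches.le_stepBound {c : Config} {n t : ℕ} (h : Reaches Λ φ n t c) :
    n ≤ stepBound Λ φ c := by
  induction h with
  | start => exact Nat.zero_le _
  | step hr hs ih =>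
    -- Only the combinatorial part of the invariant matters for counting, so any universe will do.
    have := stepBound_step (Reaches.invariant.{0} hr) hs
    omega

theorem Reaches.steps_le {c : Config} {n t : ℕ} (h : Reaches Λ φ n t c) :
    n ≤ 22 * length φ ^ 2 := by
  have h1 := h.le_stepBound
  have h2 := (stepBound_le (Reaches.invariant.{0} h)).1
  omega

/-! ### The cost of a step -/

theorem lookupCost_le (hS : S.size ≤ bound Λ φ + 2) {ψ : Form} (hψ : ψ.length ≤ length φ + 1) :
    lookupCost φ S ψ ≤ 7 * length φ ^ 2 := by
  have hN := bound_le_length Λ φ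
  have hl := length_pos φ
  have h1 : ∑ χ ∈ insert .top (Cl φ), (χ.length + ψ.length) ≤
      (insert Form.top (Cl φ)).card • (3 * length φ) :=
    Finset.sum_le_card_nsmul _ _ _ fun χ hχ => by have := length_le_of_mem hχ; omega
  have h2 := Nat.mul_le_mul_right (3 * length φ) (card_insert_Cl_le φ)
  rw [smul_eq_mul] at h1
  rw [lookupCost]
  nlinarith

/-- Thirteen units of `7|φ|^3` suffice: six and four for the fixed lookups, two for `ξ`, one for all
the literals of an implication, which number at most `|φ|`. -/
theorem tryCost_le (hS : S.size ≤ bound Λ φ + 2) {ψ : Form} (hψ : ψ ∈ insert .top (Cl φ)) :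
    tryCost φ S ψ ≤ 91 * length φ ^ 3 := by
  have hl := length_pos φ
  have hlen := length_le_of_mem hψ
  have h1 := lookupCost_le (Λ := Λ) (φ := φ) (ψ := ψ.box) hS
    (by simp only [Form.length, Form.toModal, Modal.length] at *; omega)
  have h2 := lookupCost_le (Λ := Λ) (φ := φ) hS (ψ := ψ) (by omega)
  have hp : length φ ^ 2 ≤ length φ ^ 3 := Nat.pow_le_pow_right hl (by omega)
  rw [tryCost.eq_def]
  cases ψ with
  | top => simp only; omega
  | letter p => simp only; omega
  | box ξ =>
    have h3 := lookupCost_le (Λ := Λ) (φ := φ) hS (ψ := ξ)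
      (by simp only [Form.length, Form.toModal, Modal.length] at *; omega)
    simp only; omega
  | rule body head =>
    have h3 := Form.sum_length_lt_rule body head
    have h4 : ((body ++ head.toList).map fun l => lookupCost φ S l.toForm).sum ≤
        (body ++ head.toList).length * (7 * length φ ^ 2) := by
      refine (List.sum_le_card_nsmul _ (7 * length φ ^ 2) ?_).trans (by simp)
      intro x hx
      obtain ⟨l, hl, rfl⟩ := List.mem_map.1 hx
      refine lookupCost_le (Λ := Λ) hS ?_
      have := length_le_of_mem
        (Finset.mem_insert_of_mem (b := Form.top) (mem_Cl_of_rule (by simpa using hψ) hl))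
      omega
    have h5 : (body ++ head.toList).length ≤
        ((body ++ head.toList).map fun l => l.toModal.length).sum := by
      generalize body ++ head.toList = L
      induction L with
      | nil => simp
      | cons a L ih =>
        have := a.toModal.length_pos
        simp only [List.length_cons, List.map_cons, List.sum_cons]; omega
    have h6 := Nat.mul_le_mul_right (7 * length φ ^ 2)
      (show (body ++ head.toList).length ≤ length φ by omega)
    have h7 : length φ * (7 * length φ ^ 2) = 7 * length φ ^ 3 := by ring
    simp only; omega

theorem searchCost_le (hS : S.size ≤ bound Λ φ + 2) (hL : Labelled φ S) :
    searchCost φ S ≤ 277 * length φ ^ 5 := by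
  have hN := bound_le_length Λ φ
  have hl := length_pos φ
  have h1 : ∀ k ∈ Finset.range S.size, ∑ ψ ∈ S.label k, (1 + tryCost φ S ψ) ≤
      length φ * (92 * length φ ^ 3) := by
    intro k hk
    have hk := Finset.mem_range.1 hk
    refine (Finset.sum_le_card_nsmul _ _ (92 * length φ ^ 3) fun ψ hψ => ?_).trans
      (Nat.mul_le_mul_right _ (hL.card_label_le hk))
    have := tryCost_le hS (hL.Cl k hk ψ hψ)
    have := Nat.pow_pos (n := 3) hl
    omega
  have h2 := Finset.sum_le_card_nsmul _ _ _ h1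
  rw [Finset.card_range, smul_eq_mul] at h2
  have h3 := Nat.mul_le_mul_right (length φ * (92 * length φ ^ 3))
    (show S.size ≤ 3 * length φ by omega)
  have h4 : 3 * length φ * (length φ * (92 * length φ ^ 3)) = 276 * length φ ^ 5 := by ring
  have h5 := Nat.pow_pos (n := 5) hl
  rw [searchCost]
  omega

theorem worldCost_le (hS : S.size ≤ bound Λ φ + 2) : worldCost φ S ≤ 6 * length φ ^ 5 := by
  have hN := bound_le_length Λ φ
  have hl := length_pos φ
  have h1 := Finset.card_le_card (Finset.subset_insert Form.top (Cl φ))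
  have h2 := card_insert_Cl_le φ
  have h3 := Nat.le_self_pow (n := 5) (by omega) (length φ)
  rw [worldCost]
  omega

theorem boxesCost_le (hS : S.size ≤ bound Λ φ + 2) : boxesCost φ S ≤ 8 * length φ ^ 5 := by
  have hl := length_pos φ
  have h1 : boxesCost φ S ≤ (Cl φ).card • (8 * length φ ^ 2) :=
    Finset.sum_le_card_nsmul _ _ _ fun χ hχ => by
      have := length_le_of_mem (Finset.mem_insert_of_mem (b := Form.top) hχ)
      have := lookupCost_le (Λ := Λ) (φ := φ) hS (ψ := χ) (by omega)
      have := Nat.le_self_pow (n := 2) (by omega) (length φ)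
      omega
  have h2 := Finset.card_le_card (Finset.subset_insert Form.top (Cl φ))
  have h3 := Nat.mul_le_mul_right (8 * length φ ^ 2) (h2.trans (card_insert_Cl_le φ))
  have h4 : length φ * (8 * length φ ^ 2) = 8 * length φ ^ 3 := by ring
  have h5 : length φ ^ 3 ≤ length φ ^ 5 := Nat.pow_le_pow_right hl (by omega)
  rw [smul_eq_mul] at h1
  omega

theorem initCost_le (φ : HornBoxFormula) : initCost φ ≤ 3 * length φ ^ 5 := by
  have hl := length_pos φ
  have h1 : ∑ χ ∈ insert .top (Cl φ), (χ.length + length φ) ≤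
      (insert Form.top (Cl φ)).card • (2 * length φ) :=
    Finset.sum_le_card_nsmul _ _ _ fun χ hχ => by have := length_le_of_mem hχ; omega
  have h2 := Nat.mul_le_mul_right (2 * length φ) (card_insert_Cl_le φ)
  rw [smul_eq_mul] at h1
  have h3 := Nat.pow_pos (n := 2) hl
  have h4 : length φ * (2 * length φ) = 2 * length φ ^ 2 := by ring
  have h5 := Nat.mul_le_mul_left (length φ)
    (show 1 + ∑ χ ∈ insert .top (Cl φ), (χ.length + length φ) ≤ 3 * length φ ^ 2 by omega)
  have h6 : length φ * (3 * length φ ^ 2) = 3 * length φ ^ 3 := by ring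
  have h7 : length φ ^ 3 ≤ length φ ^ 5 := Nat.pow_le_pow_right hl (by omega)
  rw [initCost]
  omega

theorem Step.cost_le {c c' : Config} {t : ℕ} (hc : Invariant.{u} Λ φ c)
    (h : Step Λ φ c t c') : t ≤ 283 * length φ ^ 5 := by
  have hp := Nat.pow_pos (n := 5) (length_pos φ)
  have hsat : ∀ c j S, Invariant.{u} Λ φ (.saturate c j S) →
      S.size ≤ bound Λ φ + 2 ∧ Labelled φ S := by
    intro c j S h
    cases c with
    | main => exact ⟨by have := h.1; have := h.2.1; omega, h.2.2.1⟩
    | shorten => exact ⟨by have := h.1; have := h.2.2.1; omega, h.2.2.2.1⟩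
  cases h with
  | init => have := initCost_le φ; omega
  | mainCall d S hd => omega
  | mainEnd d S hd => omega
  | iterate c j S S' k ψ hk hψ hS' _ =>
    have := searchCost_le (hsat _ _ _ hc).1 (hsat _ _ _ hc).2
    omega
  | mainTrue d S hS =>
    have := searchCost_le (hsat _ _ _ hc).1 (hsat _ _ _ hc).2
    have := worldCost_le (hsat _ _ _ hc).1
    omega
  | mainFalse d S k ψ hk hψ hS =>
    have := searchCost_le (hsat _ _ _ hc).1 (hsat _ _ _ hc).2
    omega
  | shortenCall k S hk =>
    have hs : S.size ≤ bound Λ φ + 2 := by have := hc.1; have := hc.2.1; omega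
    have := worldCost_le hs
    have := boxesCost_le hs
    omega
  | shortenEnd S => omega
  | shortenTrue k S hS =>
    have := searchCost_le (hsat _ _ _ hc).1 (hsat _ _ _ hc).2
    omega
  | shortenFalse j S k ψ hk hψ hS =>
    have := searchCost_le (hsat _ _ _ hc).1 (hsat _ _ _ hc).2
    omega

theorem Reaches.time_le {c : Config} {n t : ℕ} (h : Reaches Λ φ n t c) :
    t ≤ n * (283 * length φ ^ 5) := by
  induction h with
  | start => exact Nat.zero_le _
  | step hr hs ih =>
    rw [Nat.succ_mul]
    exact Nat.add_le_add ih (hs.cost_le (Reaches.invariant.{0} hr))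

end

end HornBox

theorem mainTheorem3 :
    -- every execution that ends returns True if the formula is satisfiable, and False otherwise
    (∀ (Λ : HornBox.Logic) (φ : HornBox.HornBoxFormula) (n t : ℕ) (answer : Bool),
      HornBox.Reaches Λ φ n t (.halted answer) →
        (answer = true ↔ HornBox.HornBoxFormula.Satisfiable.{u} Λ φ)) ∧
    -- no execution gets stuck before it ends
    (∀ (Λ : HornBox.Logic) (φ : HornBox.HornBoxFormula) (n t : ℕ) (c : HornBox.Config),
      HornBox.Reaches Λ φ n t c →
        (∃ answer, c = .halted answer) ∨ ∃ s c', HornBox.Step Λ φ c s c') ∧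
    -- every execution ends within cubically many steps, and in polynomial time
    (∃ (C : ℕ) (P : Polynomial ℕ), ∀ (Λ : HornBox.Logic) (φ : HornBox.HornBoxFormula) (n t : ℕ)
      (c : HornBox.Config), HornBox.Reaches Λ φ n t c →
        n ≤ C * HornBox.HornBoxFormula.length φ ^ 3 ∧
          t ≤ P.eval (HornBox.HornBoxFormula.length φ)) := by
  refine ⟨fun Λ φ n t answer h => ⟨h.invariant, ?_⟩,
    fun Λ φ n t c _ => HornBox.halted_or_exists_step Λ φ c,
    -- The polynomial is the quadratic bound on the steps times the bound on the cost of one step.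
    22, .C 22 * .X ^ 2 * (.C 283 * .X ^ 5), fun Λ φ n t c h => ⟨?_, ?_⟩⟩
  · rintro ⟨W, M, w, hM, hw⟩
    exact h.sound hM hw
  · exact h.steps_le.trans (Nat.mul_le_mul_left _
      (Nat.pow_le_pow_right (HornBox.HornBoxFormula.length_pos φ) (by omega)))
  · simp only [Polynomial.eval_mul, Polynomial.eval_C, Polynomial.eval_pow, Polynomial.eval_X]
    exact h.time_le.trans (Nat.mul_le_mul_right _ h.steps_le)
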